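/- Let $b\ge 2$ be an integer and $c>1$ a real number. For $H\ge 0$ let $T$ be the complete $b$-ary tree of height $H$, with $n=b^H$ leaves. For leaves $u,v$ let $h(u,v)$ be the height of the smallest complete subtree of $T$ containing $u$ and $v$. The undirected CGA random graph $G$ has the leaves of $T$ as vertices; independently for each unordered pair of (not necessarily distinct) leaves $u,v$, the edge $uv$ is present with probability $c^{-h(u,v)}$. In particular, since $h(v,v)=0$, every vertex carries a loop. For a vertex $v$ and a set $M$ of vertices let $e(v,M)$ be the number of $u\in M$ such that $uv$ is an edge (a loop at $v\in M$ counts once). A set $M$ is an $(\alpha,\beta)$-cluster if $e(v,M)\ge\beta|M|$ for all $v\in M$ and $e(u,M)\le\alpha|M|$ for all $u\notin M$. The height of $M$ is the height of the minimum complete subtree of $T$ containing $M$, and a set (or cluster) of height $h$ is complete if it has $b^h$ elements. "A.a.s." means with probability tending to $1$ as $H\to\infty$ (hence $n=b^H\to\infty$), with $b,c,\alpha,\beta,\epsilon$ fixed. **Theorem.** Let $0<\alpha,\beta\le 1$ and $\epsilon>0$. (a) A.a.s. there exist $(\alpha,\beta)$-clusters in $G$ of size larger than $(\ln n)^{1/2-\epsilon}$.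 Moreover, with $m^\star=\frac{\ln b}{\alpha\ln c}$, there is a constant $\gamma=\gamma(\alpha,b,c)>0$ (not depending on $\beta$ and $\epsilon$) such that for every integer $h=h(n)\ge 0$, constant or varying with $n$, which satisfies for all large $n$ $$\log_b m^\star<h\le\Bigl(\tfrac12-\epsilon\Bigr)\frac{\ln\ln n}{\ln b},$$ there are a.a.s. at least $(\ln n)^{\gamma b^h}$ complete $(\alpha,\beta)$-clusters of size $b^h$. (b) A.a.s. there is no $(\alpha,\beta)$-cluster with more than $(\ln n)^{1/2+\epsilon}$ vertices. -/

import Mathlib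

open Filter Topology MeasureTheory ProbabilityTheory

namespace CGA

/-- The leaves of the complete `b`-ary tree of height `H`. A leaf is encoded by the path that leads
to it from the root: the `i`-th letter says which of the `b` children is taken at depth `i`. -/
abbrev Leaf (b H : ℕ) : Type := Fin H → Fin b

/-- The leaf set of the complete subtree of height `k` that contains the leaf `v`: its root is
the node reached by the first `H - k` letters of `v`. -/
def subtree {b H : ℕ} (v : Leaf b H) (k : ℕ) : Finset (Leaf b H) :=
  Finset.univ.filter fun u => ∀ i : Fin H, (i : ℕ) < H - k → u i = v i

/-- The height of a set of leaves: the height of the minimum complete subtree containing it. -/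
noncomputable def height {b H : ℕ} (M : Finset (Leaf b H)) : ℕ :=
  sInf {k | ∃ v : Leaf b H, M ⊆ subtree v k}

/-- The height `h(u,v)` of a pair of leaves. -/
noncomputable def pairHeight {b H : ℕ} (u v : Leaf b H) : ℕ := height {u, v}

theorem pairHeight_comm {b H : ℕ} (u v : Leaf b H) : pairHeight u v = pairHeight v u := by
  rw [pairHeight, pairHeight, Finset.pair_comm]

/-- The height of an unordered pair of leaves. -/
noncomputable def edgeHeight {b H : ℕ} : Sym2 (Leaf b H) → ℕ :=
  Sym2.lift ⟨pairHeight, pairHeight_comm⟩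

/-- A set of leaves of height `h` is complete if it has `b ^ h` elements. -/
def IsComplete {b H : ℕ} (M : Finset (Leaf b H)) : Prop := M.card = b ^ height M

/-- An undirected graph on the leaves, loops allowed, given by the indicator of its edge set. -/
abbrev Graph (b H : ℕ) : Type := Sym2 (Leaf b H) → Bool

/-- The probability `c ^ (-h)` of a potential edge of height `h`. -/
noncomputable def edgeProb (c : ℝ) (hc : 1 < c) (h : ℕ) : unitInterval :=
  ⟨(c ^ h)⁻¹, inv_nonneg.2 (pow_nonneg (zero_le_one.trans hc.le) h),
    inv_le_one_of_one_le₀ (one_le_pow₀ hc.le)⟩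

/-- The law of the undirected CGA random graph: the potential edges `s(u, v)` are present
independently of each other, with probabilities `c ^ (-h(u,v))`. For `u = v` this probability
is `c ^ 0 = 1`, so that almost surely each vertex has a loop. -/
noncomputable def law (b H : ℕ) (c : ℝ) (hc : 1 < c) : Measure (Graph b H) :=
  Measure.pi fun e => bernoulliMeasure true false (edgeProb c hc (edgeHeight e))

/-- The number `e(v, M)` of edges between the vertex `v` and the set `M`
(a loop at `v ∈ M` counts once). -/
def edgesTo {b H : ℕ} (G : Graph b H) (v : Leaf b H) (M : Finset (Leaf b H)) : ℕ :=
  (M.filter fun u => G s(v, u) = true).card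

/-- An `(α, β)`-cluster: an internally dense and externally sparse set of vertices. -/
structure IsCluster {b H : ℕ} (α β : ℝ) (G : Graph b H) (M : Finset (Leaf b H)) : Prop where
  internally_dense : ∀ v ∈ M, β * (M.card : ℝ) ≤ (edgesTo G v M : ℝ)
  externally_sparse : ∀ u, u ∉ M → (edgesTo G u M : ℝ) ≤ α * (M.card : ℝ)

/-- The event `P` holds asymptotically almost surely, as the height of the tree grows. -/
def AAS (b : ℕ) (c : ℝ) (hc : 1 < c) (P : ∀ H : ℕ, Graph b H → Prop) : Prop :=
  Tendsto (fun H : ℕ => law b H c hc {G | P H G}) atTop (𝓝 1)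

/-- The logarithm `ln n` of the number `n = b ^ H` of vertices. -/
noncomputable def logSize (b H : ℕ) : ℝ := Real.log ((b ^ H : ℕ) : ℝ)

end CGA

/-!
Write `L = ln n = H ln b` and `m` for the size of a cluster. Why is `L ^ (1 / 2)` the threshold?
A set of `m` leaves has about `m ^ 2` internal pairs, so that being internally dense costs a
probability `exp (-Θ(m ^ 2))` up to logarithmic factors in the exponent, whereas the tree offers
`n = exp L` places for the set.

*Below the threshold*, consider the complete subtrees of height `h`, with `m = b ^ h` leaves, one in
each complete subtree of height `h + t`, where `t → ∞` slowly. Such a subtree is a clique without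
edges to the rest of the larger subtree with probability `n ^ (-o(1))` (`le_law_isolatedClique`).
These events depend on disjoint sets of edges, so by the second moment method
(`measureReal_count_lt_le`) `n ^ (1 - o(1))` of them hold. An isolated clique is a cluster unless a
vertex outside the larger subtree has more than `α m` neighbours in it. There are at most `b ^ k`
vertices at height `k`, and each of them violates the bound with probability at most
`2 ^ m c ^ (-k α m)`; since `m > m⋆` means `b < c ^ (α m)`, the sum over `k ≥ t` tends to `0`
(`sum_far_le`). These far edges are independent of the near ones, hence only a vanishing proportion
of the isolated cliques is spoilt. The number of clusters found this way exceeds `L ^ (b ^ h)`, so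
`γ = 1` will do.

*Above the threshold* only internal density matters. A naive union bound over all `n ^ m` sets is
too weak, since `m` may be far smaller than `L`. But a cluster `M` has at most `r = O(1 / β)` centres
such that every `v ∈ M` has at most `β m / 2` elements of `M` nearer to it than its nearest centre,
at height `d v` (`exists_centres`). So `v` has `β m / 2` neighbours in `M` at height at least `d v`,
which costs a factor `c ^ (-β m d v / 4)` per vertex and pays for the at most `r b ^ (d v)` choices
of `v`. Only the `n ^ r = exp (r L)` choices of the centres remain. Every vertex also has many
neighbours at height at least a large constant `l`, and this yields the factor
`c ^ (-β l m ^ 2 / 16)`, which beats `exp (r L)` (`law_exists_cluster_le`).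
-/

namespace CGA

/-! ### Balls and heights in the tree -/

section Tree

variable {b H : ℕ}

theorem mem_subtree {u v : Leaf b H} {k : ℕ} :
    u ∈ subtree v k ↔ ∀ i : Fin H, (i : ℕ) < H - k → u i = v i := by
  simp [subtree]

theorem mem_subtree_self (v : Leaf b H) (k : ℕ) : v ∈ subtree v k :=
  mem_subtree.2 fun _ _ => rfl

theorem subtree_mono (v : Leaf b H) {k l : ℕ} (hkl : k ≤ l) : subtree v k ⊆ subtree v l :=
  fun _ hu => mem_subtree.2 fun i hi => mem_subtree.1 hu i (by omega)

theorem card_subtree (v : Leaf b H) {k : ℕ} (hk : k ≤ H) : (subtree v k).card = b ^ k := by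
  have h1 : subtree v k = Fintype.piFinset fun i : Fin H =>
      if (i : ℕ) < H - k then {v i} else Finset.univ := by
    ext u
    simp only [mem_subtree, Fintype.mem_piFinset]
    refine forall_congr' fun i => ?_
    split_ifs with h <;> simp [h]
  rw [h1, Fintype.card_piFinset]
  have h2 : ∀ i : Fin H, (if (i : ℕ) < H - k then {v i} else Finset.univ : Finset (Fin b)).card
      = (fun j : ℕ => if j < H - k then 1 else b) i := by
    intro i
    dsimp only
    split_ifs <;> simp
  rw [Finset.prod_congr rfl fun i _ => h2 i,
    Fin.prod_univ_eq_prod_range (fun j : ℕ => if j < H - k then 1 else b) H]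
  obtain ⟨r, rfl⟩ := Nat.exists_eq_add_of_le' hk
  rw [Finset.prod_range_add, Finset.prod_eq_one, Finset.prod_congr rfl (g := fun _ => b)]
  · simp
  · intro i _
    simp
  · intro i hi
    simp at hi
    simp [hi]

theorem height_le_iff {M : Finset (Leaf b H)} (hM : M.Nonempty) {k : ℕ} :
    height M ≤ k ↔ ∃ v, M ⊆ subtree v k := by
  constructor
  · intro h
    obtain ⟨w, _⟩ := hM
    have hne : {k | ∃ v : Leaf b H, M ⊆ subtree v k}.Nonempty :=
      ⟨H, w, fun u _ => mem_subtree.2 fun i hi => by omega⟩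
    obtain ⟨v, hv⟩ := Nat.sInf_mem hne
    exact ⟨v, hv.trans (subtree_mono v h)⟩
  · exact fun h => Nat.sInf_le h

theorem pairHeight_le_iff {u v : Leaf b H} {k : ℕ} :
    pairHeight u v ≤ k ↔ u ∈ subtree v k := by
  rw [pairHeight, height_le_iff (by simp)]
  constructor
  · rintro ⟨w, hw⟩
    have hu := mem_subtree.1 (hw (by simp : u ∈ ({u, v} : Finset (Leaf b H))))
    have hv := mem_subtree.1 (hw (by simp : v ∈ ({u, v} : Finset (Leaf b H))))
    exact mem_subtree.2 fun i hi => (hu i hi).trans (hv i hi).symm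
  · intro h
    refine ⟨v, fun x hx => ?_⟩
    rcases Finset.mem_insert.1 hx with rfl | hx
    · exact h
    · rw [Finset.mem_singleton.1 hx]
      exact mem_subtree_self v k

theorem pairHeight_le (u v : Leaf b H) : pairHeight u v ≤ H :=
  pairHeight_le_iff.2 (mem_subtree.2 fun i hi => by omega)

/-- The height of pairs is an ultrametric. -/
theorem pairHeight_trans {u v w : Leaf b H} {k : ℕ} (huv : pairHeight u v ≤ k)
    (hvw : pairHeight v w ≤ k) : pairHeight u w ≤ k := by
  rw [pairHeight_le_iff, mem_subtree] at *
  exact fun i hi => (huv i hi).trans (hvw i hi)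

@[simp] theorem edgeHeight_mk (u v : Leaf b H) : edgeHeight s(u, v) = pairHeight u v := rfl

theorem card_filter_pairHeight_le (v : Leaf b H) (M : Finset (Leaf b H)) {k : ℕ} (hb : 1 ≤ b) :
    (M.filter fun u => pairHeight u v ≤ k).card ≤ b ^ k := by
  calc (M.filter fun u => pairHeight u v ≤ k).card ≤ (subtree v (min k H)).card := by
        refine Finset.card_le_card fun u hu => pairHeight_le_iff.1 ?_
        exact le_min (Finset.mem_filter.1 hu).2 (pairHeight_le u v)
    _ = b ^ min k H := card_subtree v (min_le_right _ _)
    _ ≤ b ^ k := Nat.pow_le_pow_right hb (min_le_left _ _)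

/-- There are at most `b ^ k` leaves at distance `k` of a given one. -/
theorem sum_pairHeight_le (hb : 1 ≤ b) (v : Leaf b H) {f : ℕ → ℝ} (hf : ∀ k, 0 ≤ f k) :
    ∑ u : Leaf b H, f (pairHeight u v) ≤ ∑ k ∈ Finset.range (H + 1), (b : ℝ) ^ k * f k := by
  rw [← Finset.sum_fiberwise_of_maps_to (s := Finset.univ) (t := Finset.range (H + 1))
    (g := fun u => pairHeight u v) fun u _ => Finset.mem_range_succ_iff.2 (pairHeight_le u v)]
  refine Finset.sum_le_sum fun k _ => ?_
  rw [Finset.sum_congr rfl (g := fun _ => f k)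
    fun u hu => by rw [(Finset.mem_filter.1 hu).2], Finset.sum_const, nsmul_eq_mul]
  refine mul_le_mul_of_nonneg_right ?_ (hf k)
  have h := (Finset.card_le_card (Finset.monotone_filter_right Finset.univ
    (fun u _ (hu : pairHeight u v = k) => hu.le))).trans
      (card_filter_pairHeight_le v Finset.univ (k := k) hb)
  exact_mod_cast h

theorem height_subtree (hb : 2 ≤ b) (v : Leaf b H) {k : ℕ} (hk : k ≤ H) :
    height (subtree v k) = k := by
  have hne : (subtree v k).Nonempty := ⟨v, mem_subtree_self v k⟩
  refine le_antisymm ((height_le_iff hne).2 ⟨v, subset_rfl⟩) ?_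
  by_contra! hlt
  obtain ⟨w, hw⟩ := (height_le_iff hne).1 le_rfl
  have h := Finset.card_le_card hw
  rw [card_subtree v hk, card_subtree w (hlt.le.trans hk)] at h
  exact absurd h (not_le.2 (Nat.pow_lt_pow_right hb hlt))

theorem isComplete_subtree (hb : 2 ≤ b) (v : Leaf b H) {k : ℕ} (hk : k ≤ H) :
    IsComplete (subtree v k) := by
  rw [IsComplete, height_subtree hb v hk, card_subtree v hk]

/-- One leaf in each complete subtree of height `k`. -/
theorem exists_separated (hb : 1 ≤ b) {k : ℕ} (hk : k ≤ H) :
    ∃ R : Finset (Leaf b H), (∀ v ∈ R, ∀ w ∈ R, v ≠ w → k < pairHeight v w) ∧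
      b ^ H ≤ R.card * b ^ k := by
  let z : Fin b := ⟨0, hb⟩
  let R : Finset (Leaf b H) := Finset.univ.filter fun v => ∀ i : Fin H, H - k ≤ (i : ℕ) → v i = z
  refine ⟨R, ?_, ?_⟩
  · intro v hv w hw hne
    by_contra! hle
    refine hne (funext fun i => ?_)
    rcases lt_or_ge (i : ℕ) (H - k) with hi | hi
    · exact mem_subtree.1 (pairHeight_le_iff.1 hle) i hi
    · rw [(Finset.mem_filter.1 hv).2 i hi, (Finset.mem_filter.1 hw).2 i hi]
  · have hcover : (Finset.univ : Finset (Leaf b H)) ⊆ R.biUnion fun v => subtree v k := by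
      intro u _
      let v : Leaf b H := fun i => if (i : ℕ) < H - k then u i else z
      refine Finset.mem_biUnion.2 ⟨v, ?_, mem_subtree.2 fun i hi => by simp [v, hi]⟩
      exact Finset.mem_filter.2 ⟨Finset.mem_univ _, fun i hi => by simp [v, not_lt.2 hi]⟩
    calc b ^ H = (Finset.univ : Finset (Leaf b H)).card := by simp
      _ ≤ (R.biUnion fun v => subtree v k).card := Finset.card_le_card hcover
      _ ≤ R.card * b ^ k :=
        Finset.card_biUnion_le_card_mul _ _ _ fun v _ => (card_subtree v hk).le

end Tree

/-! ### Probabilities of finite sets of edges -/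

section Probability

variable {b H : ℕ} {c : ℝ} {hc : 1 < c}

instance : IsProbabilityMeasure (law b H c hc) := by
  unfold law
  infer_instance

/-- The probability that the potential edge `e` has the state `s`. -/
noncomputable def stateProb (c : ℝ) (s : Bool) (e : Sym2 (Leaf b H)) : ℝ :=
  if s then (c ^ edgeHeight e)⁻¹ else 1 - (c ^ edgeHeight e)⁻¹

theorem inv_pow_le_one (hc : 1 < c) (k : ℕ) : (c ^ k)⁻¹ ≤ 1 :=
  inv_le_one_of_one_le₀ (one_le_pow₀ hc.le)

/-- The edges are independent: the probability of a cylinder event is a product. -/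
theorem law_cylinder (D : Finset (Sym2 (Leaf b H))) (s : Sym2 (Leaf b H) → Bool) :
    (law b H c hc).real {G | ∀ e ∈ D, G e = s e} = ∏ e ∈ D, stateProb c (s e) e := by
  classical
  have hset : {G : Graph b H | ∀ e ∈ D, G e = s e}
      = Set.univ.pi fun e => if e ∈ D then {s e} else Set.univ := by
    ext G
    simp only [Set.mem_ofPred_eq, Set.mem_pi, Set.mem_univ, true_implies]
    refine forall_congr' fun e => ?_
    split_ifs with he <;> simp [he]
  rw [hset, law, measureReal_def, Measure.pi_pi, ENNReal.toReal_prod,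
    ← Finset.prod_subset (Finset.subset_univ D)]
  · refine Finset.prod_congr rfl fun e he => ?_
    rw [if_pos he, ← measureReal_def,
      bernoulliMeasure_real_apply _ (MeasurableSet.of_discrete)]
    cases hs : s e <;> simp [stateProb, edgeProb]
  · intro e _ he
    simp [he]

theorem law_all_present (D : Finset (Sym2 (Leaf b H))) :
    (law b H c hc).real {G | ∀ e ∈ D, G e = true} = ∏ e ∈ D, (c ^ edgeHeight e)⁻¹ := by
  have h := law_cylinder (hc := hc) D fun _ => true
  simpa [stateProb] using h

theorem law_cylinder_inter {D D' : Finset (Sym2 (Leaf b H))} (hD : Disjoint D D')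
    (s s' : Sym2 (Leaf b H) → Bool) :
    (law b H c hc).real ({G | ∀ e ∈ D, G e = s e} ∩ {G | ∀ e ∈ D', G e = s' e}) =
      (law b H c hc).real {G | ∀ e ∈ D, G e = s e} *
        (law b H c hc).real {G | ∀ e ∈ D', G e = s' e} := by
  classical
  have hne : ∀ e ∈ D', e ∉ D := fun e he he' => Finset.disjoint_left.1 hD he' he
  have hset : {G : Graph b H | ∀ e ∈ D, G e = s e} ∩ {G | ∀ e ∈ D', G e = s' e}
      = {G | ∀ e ∈ D ∪ D', G e = if e ∈ D then s e else s' e} := by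
    ext G
    simp only [Set.mem_inter_iff, Set.mem_ofPred_eq, Finset.mem_union, or_imp, forall_and]
    refine and_congr (forall₂_congr fun e he => by rw [if_pos he])
      (forall₂_congr fun e he => by rw [if_neg (hne e he)])
  rw [hset, law_cylinder, law_cylinder, law_cylinder, Finset.prod_union hD]
  congr 1
  · exact Finset.prod_congr rfl fun e he => by rw [if_pos he]
  · exact Finset.prod_congr rfl fun e he => by rw [if_neg (hne e he)]

/-- A property whose failure has probability tending to `0` holds a.a.s. -/
theorem AAS_of_tendsto {P : ∀ H : ℕ, Graph b H → Prop} {δ : ℕ → ℝ}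
    (hδ : Tendsto δ atTop (𝓝 0))
    (hP : ∀ᶠ H in atTop, (law b H c hc).real {G | ¬ P H G} ≤ δ H) : AAS b c hc P := by
  have h0 : Tendsto (fun H => (law b H c hc).real {G | ¬ P H G}) atTop (𝓝 0) :=
    tendsto_of_tendsto_of_tendsto_of_le_of_le' tendsto_const_nhds hδ
      (Eventually.of_forall fun _ => measureReal_nonneg) hP
  have h1 := ENNReal.tendsto_ofReal (h0.const_sub 1)
  rw [sub_zero, ENNReal.ofReal_one] at h1
  refine h1.congr fun H => ?_
  have h2 : {G | ¬ P H G} = {G | P H G}ᶜ := rfl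
  rw [h2, measureReal_compl MeasurableSet.of_discrete, probReal_univ, sub_sub_cancel,
    ofReal_measureReal]

theorem AAS.mono {P Q : ∀ H : ℕ, Graph b H → Prop} (hP : AAS b c hc P)
    (h : ∀ᶠ H in atTop, ∀ G, P H G → Q H G) : AAS b c hc Q := by
  refine tendsto_of_tendsto_of_tendsto_of_le_of_le' hP tendsto_const_nhds ?_
    (Eventually.of_forall fun _ => prob_le_one)
  filter_upwards [h] with H hH using measure_mono fun G hG => hH G hG

end Probability

/-! ### Large internally dense sets -/

section Dense

variable {b H : ℕ} {c : ℝ} {hc : 1 < c}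

theorem exists_enumeration {X : Type*} {W : Finset X} (hW : W.Nonempty) {r : ℕ}
    (hr : W.card ≤ r) : ∃ w : Fin r → X, ∀ x ∈ W, ∃ i, w i = x := by
  obtain ⟨x₀, _⟩ := hW
  refine ⟨fun i => if hi : (i : ℕ) < W.card then (W.equivFin.symm ⟨i, hi⟩ : X) else x₀,
    fun x hx => ?_⟩
  have hlt := (W.equivFin ⟨x, hx⟩).isLt
  exact ⟨⟨W.equivFin ⟨x, hx⟩, hlt.trans_le hr⟩, by simp⟩

/-- A set of leaves has few centres such that for each of its elements `v`, the ball around `v`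
that just fails to reach the nearest centre contains few elements of the set. The centres are
chosen in the minimal balls with at least `τ` elements, which are disjoint as balls are laminar. -/
theorem exists_centres (M : Finset (Leaf b H)) {τ : ℝ} (hτ : 0 < τ) (hτM : τ ≤ M.card) {r : ℕ}
    (hr : (M.card : ℝ) ≤ r * τ) :
    ∃ w : Fin r → Leaf b H, ∀ v ∈ M, ∃ i,
      ((M.filter fun u => pairHeight u v < pairHeight v (w i)).card : ℝ) ≤ τ := by
  classical
  let B : Leaf b H → ℕ → Finset (Leaf b H) := fun v k => M.filter fun u => pairHeight u v ≤ k
  have hex : ∀ v, ∃ k, τ ≤ (B v k).card := fun v =>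
    ⟨H, by rwa [show B v H = M from Finset.filter_true_of_mem fun u _ => pairHeight_le u v]⟩
  let rad : Leaf b H → ℕ := fun v => Nat.find (hex v)
  have hrad : ∀ v, τ ≤ (B v (rad v)).card := fun v => Nat.find_spec (hex v)
  have hlt : ∀ v k, k < rad v → ((B v k).card : ℝ) < τ := fun v k hk =>
    not_le.1 (Nat.find_min (hex v) hk)
  let F : Finset (Finset (Leaf b H)) := M.image fun v => B v (rad v)
  let P : Finset (Finset (Leaf b H)) := F.filter fun T => Minimal (fun T' => T' ∈ F) T
  have hFcard : ∀ T ∈ F, τ ≤ T.card := by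
    intro T hT
    obtain ⟨v, _, rfl⟩ := Finset.mem_image.1 hT
    exact hrad v
  have hFM : ∀ T ∈ F, T ⊆ M := by
    intro T hT
    obtain ⟨v, _, rfl⟩ := Finset.mem_image.1 hT
    exact Finset.filter_subset _ _
  have hFne : ∀ T ∈ F, T.Nonempty := fun T hT => Finset.card_pos.1 (by
    have := hτ.trans_le (hFcard T hT)
    exact_mod_cast this)
  have hnest : ∀ v v' x, x ∈ B v (rad v) → x ∈ B v' (rad v') → rad v ≤ rad v' →
      B v (rad v) ⊆ B v' (rad v') := by
    intro v v' x hx hx' hle u hu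
    have h1 := (Finset.mem_filter.1 hx).2
    have h2 := (Finset.mem_filter.1 hx').2
    have h3 := Finset.mem_filter.1 hu
    rw [pairHeight_comm] at h1
    exact Finset.mem_filter.2
      ⟨h3.1, pairHeight_trans (pairHeight_trans (h3.2.trans hle) (h1.trans hle)) h2⟩
  have hdisj : (P : Set (Finset (Leaf b H))).PairwiseDisjoint id := by
    intro T hT T' hT' hne
    obtain ⟨hTF, hTm⟩ := Finset.mem_filter.1 hT
    obtain ⟨hTF', hTm'⟩ := Finset.mem_filter.1 hT'
    refine Finset.disjoint_left.2 fun x hx hx' => hne ?_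
    obtain ⟨v, _, rfl⟩ := Finset.mem_image.1 hTF
    obtain ⟨v', _, rfl⟩ := Finset.mem_image.1 hTF'
    rcases le_total (rad v) (rad v') with hle | hle
    · exact hTm'.eq_of_le hTF (hnest v v' x hx hx' hle)
    · exact (hTm.eq_of_le hTF' (hnest v' v x hx' hx hle)).symm
  have hPcard : P.card ≤ r := by
    have h1 : (P.card : ℝ) * τ ≤ r * τ := by
      calc (P.card : ℝ) * τ = ∑ T ∈ P, τ := by simp
        _ ≤ ∑ T ∈ P, (T.card : ℝ) :=
          Finset.sum_le_sum fun T hT => hFcard T (Finset.mem_filter.1 hT).1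
        _ = ((P.biUnion id).card : ℝ) := by
          rw [Finset.card_biUnion hdisj]
          simp
        _ ≤ M.card := by
          refine Nat.cast_le.2 (Finset.card_le_card (Finset.biUnion_subset.2 fun T hT => ?_))
          exact hFM T (Finset.mem_filter.1 hT).1
        _ ≤ r * τ := hr
    exact_mod_cast le_of_mul_le_mul_right h1 hτ
  have hmin : ∀ v ∈ M, ∃ T ∈ P, T ⊆ B v (rad v) := by
    intro v hv
    obtain ⟨T, hT, hTm⟩ := F.exists_le_minimal (Finset.mem_image_of_mem (fun v => B v (rad v)) hv)
    exact ⟨T, Finset.mem_filter.2 ⟨hTm.1, hTm⟩, hT⟩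
  obtain ⟨v₀, hv₀⟩ : M.Nonempty := Finset.card_pos.1 (by
    have := hτ.trans_le hτM
    exact_mod_cast this)
  obtain ⟨T₀, hT₀, _⟩ := hmin v₀ hv₀
  obtain ⟨t, ht⟩ := exists_enumeration ⟨T₀, hT₀⟩ hPcard
  have : Nonempty (Leaf b H) := ⟨v₀⟩
  have hpick : ∀ T ∈ F, ∃ x, x ∈ T := hFne
  choose! x hx using hpick
  refine ⟨fun i => x (t i), fun v hv => ?_⟩
  obtain ⟨T, hT, hTv⟩ := hmin v hv
  obtain ⟨i, rfl⟩ := ht T hT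
  refine ⟨i, ?_⟩
  have hw : pairHeight v (x (t i)) ≤ rad v := by
    rw [pairHeight_comm]
    exact (Finset.mem_filter.1 (hTv (hx _ (Finset.mem_filter.1 hT).1))).2
  dsimp only
  rcases Nat.eq_zero_or_pos (rad v) with h0 | hpos
  · rw [h0] at hw
    rw [Finset.filter_false_of_mem fun u _ => by omega]
    simpa using hτ.le
  · refine le_trans ?_ (hlt v (rad v - 1) (by omega)).le
    refine Nat.cast_le.2 (Finset.card_le_card
      (Finset.monotone_filter_right M fun u _ (hu : pairHeight u v < _) => ?_))
    show pairHeight u v ≤ rad v - 1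
    omega

/-- Each edge is seen from at most two vertices. -/
theorem sum_pairHeight_le_two_mul (G : Graph b H) (M : Finset (Leaf b H)) :
    ∑ v ∈ M, ∑ u ∈ M with G s(v, u) = true, pairHeight v u ≤
      2 * ∑ e ∈ M.sym2 with G e = true, edgeHeight e := by
  classical
  have h1 : ∑ v ∈ M, ∑ u ∈ M with G s(v, u) = true, pairHeight v u =
      ∑ p ∈ M ×ˢ M with G s(p.1, p.2) = true, edgeHeight s(p.1, p.2) := by
    rw [Finset.sum_filter, Finset.sum_product]
    refine Finset.sum_congr rfl fun v _ => ?_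
    rw [Finset.sum_filter]
    rfl
  rw [h1, ← Finset.sum_fiberwise_of_maps_to (t := M.sym2.filter fun e => G e = true)
    (g := fun p => s(p.1, p.2)) (by
      intro p hp
      simp only [Finset.mem_filter, Finset.mem_product] at hp
      simp [hp.1.1, hp.1.2, hp.2]), Finset.mul_sum]
  refine Finset.sum_le_sum fun e _ => ?_
  rw [Finset.sum_congr rfl (g := fun _ => edgeHeight e)
    fun p hp => by rw [(Finset.mem_filter.1 hp).2], Finset.sum_const, smul_eq_mul]
  refine Nat.mul_le_mul_right _ ?_
  induction e with
  | _ x y =>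
    refine (Finset.card_le_card (t := {(x, y), (y, x)}) fun p hp => ?_).trans Finset.card_le_two
    have h2 := (Finset.mem_filter.1 hp).2
    rw [Sym2.eq_iff] at h2
    simp only [Finset.mem_insert, Finset.mem_singleton, Prod.ext_iff]
    exact h2

/-- If every `v ∈ M` has `q` neighbours in `M` at height at least `D v`, then the heights of the
edges inside `M` sum to at least `q / 2 * ∑ D v`; the bound is a union bound over the possible
sets of these edges. -/
theorem law_dense_le (hc : 1 < c) (M : Finset (Leaf b H)) (D : Leaf b H → ℕ) (q : ℝ) :
    (law b H c hc).real {G | ∀ v ∈ M, q ≤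
        ((M.filter fun u => G s(v, u) = true ∧ D v ≤ pairHeight u v).card : ℝ)} ≤
      2 ^ (M.card ^ 2) * c ^ (-(q / 2 * ∑ v ∈ M, (D v : ℝ))) := by
  classical
  let 𝓔 : Finset (Finset (Sym2 (Leaf b H))) := M.sym2.powerset.filter fun E =>
    q / 2 * ∑ v ∈ M, (D v : ℝ) ≤ ((∑ e ∈ E, edgeHeight e : ℕ) : ℝ)
  have hsub : {G : Graph b H | ∀ v ∈ M, q ≤
        ((M.filter fun u => G s(v, u) = true ∧ D v ≤ pairHeight u v).card : ℝ)} ⊆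
      ⋃ E ∈ 𝓔, {G | ∀ e ∈ E, G e = true} := by
    intro G hG
    refine Set.mem_biUnion (x := M.sym2.filter fun e => G e = true)
      (Finset.mem_filter.2 ⟨Finset.mem_powerset.2 (Finset.filter_subset _ _), ?_⟩)
      fun e he => (Finset.mem_filter.1 he).2
    have h1 : ∀ v ∈ M, q * D v ≤
        ((∑ u ∈ M with G s(v, u) = true, pairHeight v u : ℕ) : ℝ) := by
      intro v hv
      calc q * D v
          ≤ ((M.filter fun u => G s(v, u) = true ∧ D v ≤ pairHeight u v).card : ℝ) * D v :=
            mul_le_mul_of_nonneg_right (hG v hv) (Nat.cast_nonneg _)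
        _ = ((∑ u ∈ M with G s(v, u) = true ∧ D v ≤ pairHeight u v, D v : ℕ) : ℝ) := by simp
        _ ≤ ((∑ u ∈ M with G s(v, u) = true ∧ D v ≤ pairHeight u v, pairHeight v u : ℕ) : ℝ) := by
            refine Nat.cast_le.2 (Finset.sum_le_sum fun u hu => ?_)
            rw [pairHeight_comm]
            exact (Finset.mem_filter.1 hu).2.2
        _ ≤ ((∑ u ∈ M with G s(v, u) = true, pairHeight v u : ℕ) : ℝ) := by
            refine Nat.cast_le.2 (Finset.sum_le_sum_of_subset ?_)
            exact Finset.monotone_filter_right M fun u _ hu => hu.1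
    have h2 := Finset.sum_le_sum h1
    have h3 : ((∑ v ∈ M, ∑ u ∈ M with G s(v, u) = true, pairHeight v u : ℕ) : ℝ) ≤
        ((2 * ∑ e ∈ M.sym2 with G e = true, edgeHeight e : ℕ) : ℝ) :=
      Nat.cast_le.2 (sum_pairHeight_le_two_mul G M)
    rw [← Finset.mul_sum] at h2
    rw [Nat.cast_mul, Nat.cast_ofNat, Nat.cast_sum] at h3
    linarith
  calc _ ≤ (law b H c hc).real (⋃ E ∈ 𝓔, {G | ∀ e ∈ E, G e = true}) :=
        measureReal_mono hsub (measure_ne_top _ _)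
    _ ≤ ∑ E ∈ 𝓔, (law b H c hc).real {G | ∀ e ∈ E, G e = true} :=
        measureReal_biUnion_finset_le _ _
    _ ≤ ∑ E ∈ 𝓔, c ^ (-(q / 2 * ∑ v ∈ M, (D v : ℝ))) := by
        refine Finset.sum_le_sum fun E hE => ?_
        rw [law_all_present, Finset.prod_inv_distrib, Finset.prod_pow_eq_pow_sum,
          ← Real.rpow_natCast, ← Real.rpow_neg (by linarith)]
        exact Real.rpow_le_rpow_of_exponent_le hc.le (neg_le_neg (Finset.mem_filter.1 hE).2)
    _ ≤ 2 ^ (M.card ^ 2) * c ^ (-(q / 2 * ∑ v ∈ M, (D v : ℝ))) := by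
        rw [Finset.sum_const, nsmul_eq_mul]
        refine mul_le_mul_of_nonneg_right ?_ (Real.rpow_nonneg (by linarith) _)
        have h1 : 𝓔.card ≤ 2 ^ M.sym2.card :=
          (Finset.card_filter_le _ _).trans (Finset.card_powerset _).le
        have h2 : M.sym2.card ≤ M.card ^ 2 := by
          rw [Finset.card_sym2, Nat.choose_two_right]
          refine Nat.div_le_of_le_mul ?_
          simp only [Nat.add_sub_cancel]
          nlinarith [Nat.le_mul_self M.card]
        exact_mod_cast h1.trans (Nat.pow_le_pow_right (by norm_num) h2)

end Dense

section NoLargeCluster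

variable {b H : ℕ} {c : ℝ} {hc : 1 < c}

/-- The height at which `v` meets the nearest of the centres `w i`. -/
noncomputable def centreHeight {r : ℕ} (w : Fin r → Leaf b H) (v : Leaf b H) : ℕ :=
  ⨅ i, pairHeight v (w i)

theorem centreHeight_le {r : ℕ} (w : Fin r → Leaf b H) (v : Leaf b H) (i : Fin r) :
    centreHeight w v ≤ pairHeight v (w i) :=
  ciInf_le (OrderBot.bddBelow _) i

theorem sum_centreHeight_le {r : ℕ} (hb : 1 ≤ b) (hr : 0 < r) (w : Fin r → Leaf b H) :
    ∑ v, ((2 * (b : ℝ)) ^ centreHeight w v)⁻¹ ≤ 2 * r := by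
  have : Nonempty (Fin r) := ⟨⟨0, hr⟩⟩
  have hb0 : (0 : ℝ) < b := by exact_mod_cast hb
  calc ∑ v, ((2 * (b : ℝ)) ^ centreHeight w v)⁻¹
      ≤ ∑ v, ∑ i, ((2 * (b : ℝ)) ^ pairHeight v (w i))⁻¹ := by
        refine Finset.sum_le_sum fun v _ => ?_
        obtain ⟨i, hi⟩ := exists_eq_ciInf_of_finite (f := fun i => pairHeight v (w i))
        rw [centreHeight, ← hi]
        exact Finset.single_le_sum (f := fun i => ((2 * (b : ℝ)) ^ pairHeight v (w i))⁻¹)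
          (fun i _ => by positivity) (Finset.mem_univ i)
    _ = ∑ i, ∑ v, ((2 * (b : ℝ)) ^ pairHeight v (w i))⁻¹ := Finset.sum_comm
    _ ≤ ∑ _i : Fin r, (2 : ℝ) := by
        refine Finset.sum_le_sum fun i _ => ?_
        refine (sum_pairHeight_le hb (w i) (f := fun k => ((2 * (b : ℝ)) ^ k)⁻¹)
          fun k => by positivity).trans ?_
        refine le_trans (le_of_eq (Finset.sum_congr rfl fun k _ => ?_))
          (sum_geometric_two_le (H + 1))
        rw [mul_pow, mul_inv, one_div, inv_pow]
        field_simp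
    _ = 2 * r := by simp [mul_comm]

/-- The first moment bound for large internally dense sets: the `(b ^ H) ^ r` choices of the
centres are the only ones of which the number depends on the size of the tree, since the elements
`v` of the set are paid for by their edges at height at least `centreHeight w v`. -/
theorem law_exists_cluster_le (hb : 1 ≤ b) (hc : 1 < c) {α β X : ℝ} (hβ : 0 < β) (hX : 0 < X)
    {l r : ℕ} (hl : 2 ≤ c ^ (β * l / 8)) (hlX : (b : ℝ) ^ l ≤ β * X / 2)
    (hcX : 2 * (b : ℝ) ≤ c ^ (β * X / 16)) (hr : 2 ≤ r * β) :
    (law b H c hc).real {G | ∃ M, IsCluster α β G M ∧ X < (M.card : ℝ)} ≤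
      ((b : ℝ) ^ H) ^ r * (Real.exp (2 * r) * c ^ (-(β * l / 16 * X ^ 2))) := by
  classical
  have hc0 : 0 < c := by linarith
  have hb0 : (0 : ℝ) < b := by exact_mod_cast hb
  have hr0 : 0 < r := by
    rcases Nat.eq_zero_or_pos r with rfl | h
    · norm_num at hr
    · exact h
  let A : (Fin r → Leaf b H) → Finset (Leaf b H) → Set (Graph b H) := fun w M =>
    {G | ∀ v ∈ M, β * M.card / 2 ≤ ((M.filter fun u =>
      G s(v, u) = true ∧ max l (centreHeight w v) ≤ pairHeight u v).card : ℝ)}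
  let 𝓜 : Finset (Finset (Leaf b H)) := Finset.univ.filter fun M => X < (M.card : ℝ)
  have hsub : {G : Graph b H | ∃ M, IsCluster α β G M ∧ X < (M.card : ℝ)} ⊆
      ⋃ w ∈ (Finset.univ : Finset (Fin r → Leaf b H)), ⋃ M ∈ 𝓜, A w M := by
    rintro G ⟨M, hM, hXM⟩
    have hm : (0 : ℝ) < M.card := hX.trans hXM
    have h1 : β * M.card / 2 ≤ M.card := by
      obtain ⟨v, hv⟩ : M.Nonempty := Finset.card_pos.1 (by exact_mod_cast hm)
      have h2 := hM.internally_dense v hv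
      have h3 : (edgesTo G v M : ℝ) ≤ M.card := Nat.cast_le.2 (Finset.card_filter_le _ _)
      have h4 : 0 < β * M.card := mul_pos hβ hm
      linarith
    obtain ⟨w, hw⟩ := exists_centres M (τ := β * M.card / 2) (by positivity) h1 (r := r) (by
      nlinarith)
    refine Set.mem_biUnion (Finset.mem_univ w) (Set.mem_biUnion
      (Finset.mem_filter.2 ⟨Finset.mem_univ M, hXM⟩) fun v hv => ?_)
    obtain ⟨i, hi⟩ := hw v hv
    have hlow : ((M.filter fun u => pairHeight u v < max l (centreHeight w v)).card : ℝ) ≤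
        β * M.card / 2 := by
      rcases le_total l (centreHeight w v) with h | h
      · rw [max_eq_right h]
        refine le_trans (Nat.cast_le.2 (Finset.card_le_card
          (Finset.monotone_filter_right M fun u _ hu => ?_))) hi
        exact lt_of_lt_of_le hu (centreHeight_le w v i)
      · rw [max_eq_left h]
        calc ((M.filter fun u => pairHeight u v < l).card : ℝ)
            ≤ ((M.filter fun u => pairHeight u v ≤ l).card : ℝ) :=
              Nat.cast_le.2 (Finset.card_le_card
                (Finset.monotone_filter_right M fun u _ (hu : pairHeight u v < l) => hu.le))
          _ ≤ (b : ℝ) ^ l := by exact_mod_cast card_filter_pairHeight_le v M hb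
          _ ≤ β * M.card / 2 := hlX.trans (by nlinarith)
    have hsplit : edgesTo G v M ≤
        (M.filter fun u => pairHeight u v < max l (centreHeight w v)).card +
        (M.filter fun u => G s(v, u) = true ∧ max l (centreHeight w v) ≤ pairHeight u v).card := by
      rw [edgesTo]
      refine le_trans (Finset.card_le_card fun u hu => ?_) (Finset.card_union_le _ _)
      obtain ⟨huM, hu⟩ := Finset.mem_filter.1 hu
      rcases lt_or_ge (pairHeight u v) (max l (centreHeight w v)) with h | h
      · exact Finset.mem_union_left _ (Finset.mem_filter.2 ⟨huM, h⟩)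
      · exact Finset.mem_union_right _ (Finset.mem_filter.2 ⟨huM, hu, h⟩)
    have h2 := hM.internally_dense v hv
    have h3 : (edgesTo G v M : ℝ) ≤
        ((M.filter fun u => pairHeight u v < max l (centreHeight w v)).card : ℝ) +
        ((M.filter fun u => G s(v, u) = true ∧
          max l (centreHeight w v) ≤ pairHeight u v).card : ℝ) := by
      exact_mod_cast hsplit
    linarith
  have hA : ∀ w, ∀ M ∈ 𝓜, (law b H c hc).real (A w M) ≤
      c ^ (-(β * l / 16 * X ^ 2)) * ∏ v ∈ M, ((2 * (b : ℝ)) ^ centreHeight w v)⁻¹ := by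
    intro w M hM
    have hXM : X < M.card := (Finset.mem_filter.1 hM).2
    set m : ℝ := (M.card : ℝ) with hm
    have hsumD : 3 * (m * l) + ∑ v ∈ M, (centreHeight w v : ℝ) ≤
        4 * ∑ v ∈ M, ((max l (centreHeight w v) : ℕ) : ℝ) := by
      have h1 : 3 * (m * l) + ∑ v ∈ M, (centreHeight w v : ℝ) =
          ∑ v ∈ M, (3 * (l : ℝ) + centreHeight w v) := by
        rw [Finset.sum_add_distrib, Finset.sum_const, nsmul_eq_mul]
        ring
      rw [h1, Finset.mul_sum]
      refine Finset.sum_le_sum fun v _ => ?_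
      have h2 : (l : ℝ) ≤ ((max l (centreHeight w v) : ℕ) : ℝ) := Nat.cast_le.2 (le_max_left _ _)
      have h3 : (centreHeight w v : ℝ) ≤ ((max l (centreHeight w v) : ℕ) : ℝ) :=
        Nat.cast_le.2 (le_max_right _ _)
      linarith
    have htwo : (2 : ℝ) ^ (M.card ^ 2) ≤ c ^ (β * l / 8 * m ^ 2) := by
      rw [Real.rpow_mul hc0.le, hm, ← Nat.cast_pow, Real.rpow_natCast]
      exact pow_le_pow_left₀ (by norm_num) hl _
    have hprod : c ^ (-(β * X / 16 * ∑ v ∈ M, (centreHeight w v : ℝ))) ≤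
        ∏ v ∈ M, ((2 * (b : ℝ)) ^ centreHeight w v)⁻¹ := by
      rw [Finset.prod_inv_distrib, Finset.prod_pow_eq_pow_sum, Real.rpow_neg hc0.le,
        Real.rpow_mul hc0.le, ← Nat.cast_sum, Real.rpow_natCast]
      exact inv_anti₀ (by positivity) (pow_le_pow_left₀ (by positivity) hcX _)
    calc (law b H c hc).real (A w M)
        ≤ 2 ^ (M.card ^ 2) * c ^ (-(β * m / 2 / 2 *
            ∑ v ∈ M, ((max l (centreHeight w v) : ℕ) : ℝ))) :=
          law_dense_le hc M (fun v => max l (centreHeight w v)) _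
      _ ≤ c ^ (β * l / 8 * m ^ 2) * c ^ (-(β * m / 2 / 2 *
            ∑ v ∈ M, ((max l (centreHeight w v) : ℕ) : ℝ))) :=
          mul_le_mul_of_nonneg_right htwo (Real.rpow_nonneg hc0.le _)
      _ = c ^ (β * l / 8 * m ^ 2 + -(β * m / 2 / 2 *
            ∑ v ∈ M, ((max l (centreHeight w v) : ℕ) : ℝ))) := (Real.rpow_add hc0 _ _).symm
      _ ≤ c ^ (-(β * l / 16 * X ^ 2) + -(β * X / 16 * ∑ v ∈ M, (centreHeight w v : ℝ))) := by
          refine Real.rpow_le_rpow_of_exponent_le hc.le ?_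
          have hS : 0 ≤ ∑ v ∈ M, (centreHeight w v : ℝ) :=
            Finset.sum_nonneg fun v _ => Nat.cast_nonneg _
          have h1 : β * m / 16 * (3 * (m * l) + ∑ v ∈ M, (centreHeight w v : ℝ)) ≤
              β * m / 16 * (4 * ∑ v ∈ M, ((max l (centreHeight w v) : ℕ) : ℝ)) :=
            mul_le_mul_of_nonneg_left hsumD (by positivity)
          have h2 : β * X / 16 * ∑ v ∈ M, (centreHeight w v : ℝ) ≤
              β * m / 16 * ∑ v ∈ M, (centreHeight w v : ℝ) :=
            mul_le_mul_of_nonneg_right (by nlinarith) hS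
          have h3 : β * l / 16 * X ^ 2 ≤ β * l / 16 * m ^ 2 :=
            mul_le_mul_of_nonneg_left (pow_le_pow_left₀ hX.le hXM.le 2) (by positivity)
          linarith
      _ = c ^ (-(β * l / 16 * X ^ 2)) * c ^ (-(β * X / 16 * ∑ v ∈ M, (centreHeight w v : ℝ))) :=
          Real.rpow_add hc0 _ _
      _ ≤ _ := mul_le_mul_of_nonneg_left hprod (Real.rpow_nonneg hc0.le _)
  calc (law b H c hc).real {G | ∃ M, IsCluster α β G M ∧ X < (M.card : ℝ)}
      ≤ (law b H c hc).real
          (⋃ w ∈ (Finset.univ : Finset (Fin r → Leaf b H)), ⋃ M ∈ 𝓜, A w M) :=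
        measureReal_mono hsub (measure_ne_top _ _)
    _ ≤ ∑ w : Fin r → Leaf b H, (law b H c hc).real (⋃ M ∈ 𝓜, A w M) :=
        measureReal_biUnion_finset_le _ _
    _ ≤ ∑ w : Fin r → Leaf b H, Real.exp (2 * r) * c ^ (-(β * l / 16 * X ^ 2)) := by
        refine Finset.sum_le_sum fun w _ => ?_
        calc (law b H c hc).real (⋃ M ∈ 𝓜, A w M)
            ≤ ∑ M ∈ 𝓜, (law b H c hc).real (A w M) := measureReal_biUnion_finset_le _ _
          _ ≤ ∑ M ∈ 𝓜, c ^ (-(β * l / 16 * X ^ 2)) *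
                ∏ v ∈ M, ((2 * (b : ℝ)) ^ centreHeight w v)⁻¹ := Finset.sum_le_sum (hA w)
          _ ≤ ∑ M ∈ Finset.univ.powerset, c ^ (-(β * l / 16 * X ^ 2)) *
                ∏ v ∈ M, ((2 * (b : ℝ)) ^ centreHeight w v)⁻¹ := by
              refine Finset.sum_le_sum_of_subset_of_nonneg (fun M _ => by simp) fun M _ _ => ?_
              exact mul_nonneg (Real.rpow_nonneg hc0.le _)
                (Finset.prod_nonneg fun v _ => by positivity)
          _ = c ^ (-(β * l / 16 * X ^ 2)) *
                ∏ v, (1 + ((2 * (b : ℝ)) ^ centreHeight w v)⁻¹) := by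
              rw [← Finset.mul_sum, Finset.prod_one_add]
          _ ≤ c ^ (-(β * l / 16 * X ^ 2)) * Real.exp (2 * r) := by
              refine mul_le_mul_of_nonneg_left ?_ (Real.rpow_nonneg hc0.le _)
              calc ∏ v, (1 + ((2 * (b : ℝ)) ^ centreHeight w v)⁻¹)
                  ≤ ∏ v, Real.exp ((2 * (b : ℝ)) ^ centreHeight w v)⁻¹ := by
                    refine Finset.prod_le_prod (fun v _ => by positivity) fun v _ => ?_
                    rw [add_comm]
                    exact Real.add_one_le_exp _
                _ = Real.exp (∑ v, ((2 * (b : ℝ)) ^ centreHeight w v)⁻¹) :=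
                    (Real.exp_sum _ _).symm
                _ ≤ Real.exp (2 * r) := Real.exp_le_exp.2 (sum_centreHeight_le hb hr0 w)
          _ = _ := mul_comm _ _
    _ = ((b : ℝ) ^ H) ^ r * (Real.exp (2 * r) * c ^ (-(β * l / 16 * X ^ 2))) := by
        simp

theorem logSize_eq (b H : ℕ) : logSize b H = H * Real.log b := by
  rw [logSize, Nat.cast_pow, Real.log_pow]

theorem exp_logSize (hb : 1 ≤ b) (H : ℕ) : Real.exp (logSize b H) = (b : ℝ) ^ H := by
  have hb0 : 0 < b := hb
  rw [logSize, Real.exp_log (by positivity), Nat.cast_pow]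

theorem log_pos_of_two_le (hb : 2 ≤ b) : 0 < Real.log b :=
  Real.log_pos (by exact_mod_cast hb)

theorem tendsto_logSize (hb : 2 ≤ b) : Tendsto (logSize b) atTop atTop := by
  have h := tendsto_natCast_atTop_atTop (R := ℝ).atTop_mul_const (log_pos_of_two_le hb)
  exact h.congr fun H => (logSize_eq b H).symm

theorem AAS_no_large_cluster (hb : 2 ≤ b) (hc : 1 < c) (α : ℝ) {β ε : ℝ} (hβ : 0 < β)
    (hε : 0 < ε) : AAS b c hc fun H G => ¬ ∃ M : Finset (Leaf b H),
      IsCluster α β G M ∧ logSize b H ^ (1 / 2 + ε : ℝ) < (M.card : ℝ) := by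
  have hlogc : 0 < Real.log c := Real.log_pos hc
  have hc0 : 0 < c := by linarith
  obtain ⟨l, hl⟩ := exists_nat_gt (8 * Real.log 2 / (β * Real.log c))
  obtain ⟨r, hr⟩ := exists_nat_gt (2 / β)
  have hl0 : 0 < (l : ℝ) := lt_of_le_of_lt (by positivity) hl
  rw [div_lt_iff₀ (by positivity)] at hl
  rw [div_lt_iff₀ hβ] at hr
  have hl2 : 2 ≤ c ^ (β * l / 8) := by
    rw [Real.le_rpow_iff_log_le two_pos hc0]
    nlinarith
  have hXtop : Tendsto (fun H => logSize b H ^ (1 / 2 + ε : ℝ)) atTop atTop :=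
    (tendsto_rpow_atTop (by positivity)).comp (tendsto_logSize hb)
  let a : ℝ := β * l / 16 * Real.log c
  have ha : 0 < a := by positivity
  refine AAS_of_tendsto (δ := fun H => Real.exp (-(logSize b H *
    (a * logSize b H ^ (2 * ε) - r)) + 2 * r)) ?_ ?_
  · refine Real.tendsto_exp_atBot.comp (tendsto_atBot_add_const_right _ _
      (tendsto_neg_atTop_atBot.comp ((tendsto_logSize hb).atTop_mul_atTop₀
        (tendsto_atTop_add_const_right _ (-(r : ℝ)) ?_))))
    exact ((tendsto_rpow_atTop (by positivity : 0 < 2 * ε)).comp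
      (tendsto_logSize hb)).const_mul_atTop ha
  · filter_upwards [hXtop.eventually_ge_atTop (2 * (b : ℝ) ^ l / β),
      hXtop.eventually_ge_atTop (16 * Real.log (2 * b) / (β * Real.log c)),
      hXtop.eventually_gt_atTop 0, (tendsto_logSize hb).eventually_gt_atTop 0]
      with H h1 h2 h3 h4
    have hb0 : (0 : ℝ) < b := by exact_mod_cast (by omega : 0 < b)
    rw [div_le_iff₀ hβ] at h1
    rw [div_le_iff₀ (by positivity)] at h2
    simp only [not_not]
    refine (law_exists_cluster_le (by omega) hc hβ h3 hl2 (by linarith) ?_ hr.le).trans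
      (le_of_eq ?_)
    · rw [Real.le_rpow_iff_log_le (by positivity) hc0]
      linarith
    · have hsq : (logSize b H ^ (1 / 2 + ε : ℝ)) ^ 2 = logSize b H * logSize b H ^ (2 * ε) := by
        rw [← Real.rpow_natCast, ← Real.rpow_mul h4.le, ← Real.rpow_one_add' h4.le (by positivity)]
        congr 1
        push_cast
        ring
      rw [hsq, ← exp_logSize (by omega) H, ← Real.exp_nat_mul, Real.rpow_def_of_pos hc0,
        ← Real.exp_add, ← Real.exp_add]
      congr 1
      simp only [a]
      ring

end NoLargeCluster

/-! ### Counting pairwise independent events -/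

/-- A second moment bound: if the events `E i` are pairwise independent and `B i` is unlikely given
`E i`, then many of the `E i` hold without `B i`. -/
theorem measureReal_count_lt_le {Ω ι : Type*} [Finite Ω] [MeasurableSpace Ω]
    [MeasurableSingletonClass Ω] (P : Measure Ω) [IsProbabilityMeasure P] (R : Finset ι)
    (E B : ι → Set Ω) {S η : ℝ} (hS : S = ∑ i ∈ R, P.real (E i)) (hS0 : 0 < S)
    (hE : ∀ i ∈ R, ∀ j ∈ R, i ≠ j → P.real (E i ∩ E j) = P.real (E i) * P.real (E j))
    (hB : ∀ i ∈ R, P.real (E i ∩ B i) ≤ η * P.real (E i))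
    (good : Ω → Finset ι) (hgood : ∀ ω, ∀ i ∈ R, ω ∈ E i → ω ∉ B i → i ∈ good ω) :
    P.real {ω | ((good ω).card : ℝ) < S / 4} ≤ 4 / S + 4 * η := by
  classical
  let X : Ω → ℝ := fun ω => ∑ i ∈ R, (E i).indicator 1 ω
  let Y : Ω → ℝ := fun ω => ∑ i ∈ R, (E i ∩ B i).indicator 1 ω
  have hind : ∀ (A : Set Ω), ∫ ω, A.indicator (1 : Ω → ℝ) ω ∂P = P.real A := fun A =>
    integral_indicator_one A.toFinite.measurableSet
  have hX1 : ∫ ω, X ω ∂P = S := by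
    rw [integral_finsetSum _ fun i _ => Integrable.of_finite, hS]
    exact Finset.sum_congr rfl fun i _ => hind _
  have hX2 : ∫ ω, X ω ^ 2 ∂P ≤ S ^ 2 + S := by
    have h1 : ∀ ω, X ω ^ 2 = ∑ i ∈ R, ∑ j ∈ R, (E i ∩ E j).indicator (1 : Ω → ℝ) ω := by
      intro ω
      rw [sq, Finset.sum_mul_sum]
      refine Finset.sum_congr rfl fun i _ => Finset.sum_congr rfl fun j _ => ?_
      rw [Set.inter_indicator_one, Pi.mul_apply]
    simp_rw [h1]
    rw [integral_finsetSum _ fun i _ => Integrable.of_finite]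
    calc ∑ i ∈ R, ∫ ω, ∑ j ∈ R, (E i ∩ E j).indicator (1 : Ω → ℝ) ω ∂P
        = ∑ i ∈ R, ∑ j ∈ R, P.real (E i ∩ E j) := by
          refine Finset.sum_congr rfl fun i _ => ?_
          rw [integral_finsetSum _ fun j _ => Integrable.of_finite]
          exact Finset.sum_congr rfl fun j _ => hind _
      _ ≤ ∑ i ∈ R, ∑ j ∈ R,
            (P.real (E i) * P.real (E j) + if i = j then P.real (E i) else 0) := by
          refine Finset.sum_le_sum fun i hi => Finset.sum_le_sum fun j hj => ?_
          split_ifs with hij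
          · subst hij
            rw [Set.inter_self]
            have := mul_nonneg (measureReal_nonneg (μ := P) (s := E i))
              (measureReal_nonneg (μ := P) (s := E i))
            linarith
          · rw [hE i hi j hj hij, add_zero]
      _ = S ^ 2 + S := by
          simp only [Finset.sum_add_distrib, Finset.sum_ite_eq]
          rw [sq, hS, Finset.sum_mul_sum]
          congr 1
          exact Finset.sum_congr rfl fun i hi => by rw [if_pos hi]
  have hvar : ∫ ω, (X ω - S) ^ 2 ∂P ≤ S := by
    have h1 : ∀ ω, (X ω - S) ^ 2 = X ω ^ 2 - 2 * S * X ω + S ^ 2 := fun ω => by ring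
    simp_rw [h1]
    rw [integral_add Integrable.of_finite Integrable.of_finite,
      integral_sub Integrable.of_finite Integrable.of_finite, integral_const_mul, hX1]
    simp only [integral_const, probReal_univ, one_smul]
    nlinarith
  have hY : ∫ ω, Y ω ∂P ≤ η * S := by
    rw [integral_finsetSum _ fun i _ => Integrable.of_finite, hS, Finset.mul_sum]
    refine Finset.sum_le_sum fun i hi => ?_
    rw [hind]
    exact hB i hi
  have hcheb := mul_meas_ge_le_integral_of_nonneg (μ := P) (f := fun ω => (X ω - S) ^ 2)
    (Eventually.of_forall fun ω => sq_nonneg _) Integrable.of_finite ((S / 2) ^ 2)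
  have hmark := mul_meas_ge_le_integral_of_nonneg (μ := P) (f := Y)
    (Eventually.of_forall fun ω => Finset.sum_nonneg fun i _ =>
      Set.indicator_nonneg (fun _ _ => zero_le_one) _) Integrable.of_finite (S / 4)
  have hcount : ∀ ω, X ω - Y ω ≤ (good ω).card := by
    intro ω
    calc X ω - Y ω = ∑ i ∈ R, ((E i).indicator 1 ω - (E i ∩ B i).indicator 1 ω) := by
          rw [Finset.sum_sub_distrib]
      _ ≤ ∑ i ∈ R, if i ∈ good ω then (1 : ℝ) else 0 := by
          refine Finset.sum_le_sum fun i hi => ?_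
          by_cases h1 : ω ∈ E i
          · by_cases h2 : ω ∈ B i
            · rw [Set.indicator_of_mem h1, Set.indicator_of_mem (show ω ∈ E i ∩ B i from ⟨h1, h2⟩)]
              split_ifs <;> simp
            · rw [if_pos (hgood ω i hi h1 h2), Set.indicator_of_mem h1,
                Set.indicator_of_notMem (show ω ∉ E i ∩ B i from fun h => h2 h.2)]
              simp
          · rw [Set.indicator_of_notMem h1, Set.indicator_of_notMem (show ω ∉ E i ∩ B i from fun h => h1 h.1)]
            split_ifs <;> simp
      _ ≤ (good ω).card := by
          rw [← Finset.sum_filter, Finset.sum_const, nsmul_one]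
          exact Nat.cast_le.2 (Finset.card_le_card fun i hi => (Finset.mem_filter.1 hi).2)
  have hsub : {ω | ((good ω).card : ℝ) < S / 4} ⊆
      {ω | (S / 2) ^ 2 ≤ (X ω - S) ^ 2} ∪ {ω | S / 4 ≤ Y ω} := by
    intro ω hω
    have hω : ((good ω).card : ℝ) < S / 4 := hω
    by_contra hcon
    simp only [Set.mem_union, Set.mem_ofPred_eq, not_or, not_le] at hcon
    have h1 := abs_lt_of_sq_lt_sq hcon.1 (by positivity)
    have h2 := (abs_lt.1 h1).1
    linarith [hcount ω, hcon.2]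
  refine (measureReal_mono hsub (measure_ne_top _ _)).trans
    ((measureReal_union_le _ _).trans (add_le_add ?_ ?_))
  · rw [le_div_iff₀ hS0]
    have h1 := hcheb.trans hvar
    have h2 : (S / 4 * S) * P.real {ω | (S / 2) ^ 2 ≤ (X ω - S) ^ 2} ≤ S := by
      calc _ = (S / 2) ^ 2 * P.real {ω | (S / 2) ^ 2 ≤ (X ω - S) ^ 2} := by ring
        _ ≤ S := h1
    have h3 : S * (P.real {ω | (S / 2) ^ 2 ≤ (X ω - S) ^ 2} * S) ≤ S * 4 := by linarith
    exact le_of_mul_le_mul_left h3 hS0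
  · have h1 := hmark.trans hY
    have h3 : S * P.real {ω | S / 4 ≤ Y ω} ≤ S * (4 * η) := by linarith
    exact le_of_mul_le_mul_left h3 hS0

/-! ### Complete subtrees that are isolated cliques -/

section Isolated

variable {b H : ℕ} {c : ℝ} {hc : 1 < c}

/-- The potential edges between the complete subtree of height `h` at `v` and the larger complete
subtree of height `h + t`. -/
noncomputable def nearEdges (v : Leaf b H) (h t : ℕ) : Finset (Sym2 (Leaf b H)) :=
  open Classical in
  (subtree v h ×ˢ subtree v (h + t)).image fun p => s(p.1, p.2)

/-- The event that the complete subtree of height `h` at `v` is a clique without edges to the rest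
of the complete subtree of height `h + t`. -/
def isolatedClique (v : Leaf b H) (h t : ℕ) : Set (Graph b H) :=
  {G | ∀ e ∈ nearEdges v h t, G e = decide (edgeHeight e ≤ h)}

/-- The event that some vertex outside the complete subtree of height `h + t` at `v` has too many
neighbours in the complete subtree of height `h`. -/
def farAttached (α : ℝ) (v : Leaf b H) (h t : ℕ) : Set (Graph b H) :=
  {G | ∃ u, u ∉ subtree v (h + t) ∧ α * ((subtree v h).card : ℝ) < edgesTo G u (subtree v h)}

theorem mem_nearEdges_of_mem {v x u : Leaf b H} {h t : ℕ} (hx : x ∈ subtree v h)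
    (hu : u ∈ subtree v (h + t)) : s(x, u) ∈ nearEdges v h t := by
  classical
  exact Finset.mem_image.2 ⟨(x, u), Finset.mem_product.2 ⟨hx, hu⟩, rfl⟩

theorem mem_subtree_of_mem_nearEdges {v u : Leaf b H} {h t : ℕ} {e : Sym2 (Leaf b H)}
    (he : e ∈ nearEdges v h t) (hu : u ∈ e) : u ∈ subtree v (h + t) := by
  classical
  obtain ⟨⟨x, y⟩, hp, rfl⟩ := Finset.mem_image.1 he
  obtain ⟨hx, hy⟩ := Finset.mem_product.1 hp
  rcases Sym2.mem_iff.1 hu with rfl | rfl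
  · exact subtree_mono v (Nat.le_add_right h t) hx
  · exact hy

theorem pairHeight_le_of_mem_subtree {v x y : Leaf b H} {k : ℕ} (hx : x ∈ subtree v k)
    (hy : y ∈ subtree v k) : pairHeight x y ≤ k := by
  refine pairHeight_trans (pairHeight_le_iff.2 hx) ?_
  rw [pairHeight_comm]
  exact pairHeight_le_iff.2 hy

theorem isCluster_of_isolatedClique {α β : ℝ} (hα : 0 ≤ α) (hβ : β ≤ 1) {v : Leaf b H} {h t : ℕ}
    {G : Graph b H} (hG : G ∈ isolatedClique v h t) (hF : G ∉ farAttached α v h t) :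
    IsCluster α β G (subtree v h) := by
  constructor
  · intro x hx
    have h1 : edgesTo G x (subtree v h) = (subtree v h).card := by
      rw [edgesTo, Finset.filter_true_of_mem]
      intro u hu
      rw [hG _ (mem_nearEdges_of_mem hx (subtree_mono v (Nat.le_add_right h t) hu))]
      exact decide_eq_true (pairHeight_le_of_mem_subtree hx hu)
    rw [h1]
    exact mul_le_of_le_one_left (Nat.cast_nonneg _) hβ
  · intro u hu
    by_cases huB : u ∈ subtree v (h + t)
    · have h1 : edgesTo G u (subtree v h) = 0 := by
        rw [edgesTo, Finset.filter_false_of_mem, Finset.card_empty]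
        intro x hx
        rw [Sym2.eq_swap, hG _ (mem_nearEdges_of_mem hx huB), Bool.not_eq_true]
        refine decide_eq_false fun hle => hu (pairHeight_le_iff.1 ?_)
        rw [edgeHeight_mk, pairHeight_comm] at hle
        exact pairHeight_trans hle (pairHeight_le_iff.2 hx)
      rw [h1, Nat.cast_zero]
      positivity
    · by_contra! hlt
      exact hF ⟨u, huB, hlt⟩

theorem le_law_isolatedClique (hc : 1 < c) {h t : ℕ} (hH : h + t ≤ H) (v : Leaf b H) :
    ((1 - c⁻¹) * (c ^ h)⁻¹) ^ (b ^ h * b ^ (h + t)) ≤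
      (law b H c hc).real (isolatedClique v h t) := by
  classical
  have hc0 : 0 < c := by linarith
  have h1 : c⁻¹ ≤ 1 := inv_le_one_of_one_le₀ hc.le
  have h2 : (c ^ h)⁻¹ ≤ 1 := inv_pow_le_one hc h
  have h3 : 0 < c⁻¹ := inv_pos.2 hc0
  have h4 : 0 < (c ^ h)⁻¹ := by positivity
  have hcard : (nearEdges v h t).card ≤ b ^ h * b ^ (h + t) := by
    refine Finset.card_image_le.trans ?_
    rw [Finset.card_product, card_subtree v hH, card_subtree v (by omega)]
  rw [isolatedClique, law_cylinder]
  refine (pow_le_pow_of_le_one (mul_nonneg (by linarith) h4.le) (by nlinarith) hcard).trans ?_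
  rw [← Finset.prod_const]
  refine Finset.prod_le_prod (fun e _ => mul_nonneg (by linarith) h4.le) fun e _ => ?_
  by_cases he : edgeHeight e ≤ h
  · rw [stateProb, decide_eq_true he, if_pos rfl]
    have h5 : (c ^ h)⁻¹ ≤ (c ^ edgeHeight e)⁻¹ :=
      inv_anti₀ (by positivity) (pow_le_pow_right₀ hc.le he)
    nlinarith
  · rw [stateProb, decide_eq_false he, if_neg Bool.false_ne_true]
    have h5 : (c ^ edgeHeight e)⁻¹ ≤ c⁻¹ :=
      inv_anti₀ hc0 (le_self_pow₀ hc.le (by omega))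
    nlinarith

theorem law_isolatedClique_inter {h t : ℕ} {v w : Leaf b H} (hvw : h + t < pairHeight v w) :
    (law b H c hc).real (isolatedClique v h t ∩ isolatedClique w h t) =
      (law b H c hc).real (isolatedClique v h t) * (law b H c hc).real (isolatedClique w h t) := by
  refine law_cylinder_inter (Finset.disjoint_left.2 fun e hv hw => ?_) _ _
  induction e with
  | _ x y =>
    have h1 := pairHeight_le_iff.2 (mem_subtree_of_mem_nearEdges hv (Sym2.mem_mk_left x y))
    have h2 := pairHeight_le_iff.2 (mem_subtree_of_mem_nearEdges hw (Sym2.mem_mk_left x y))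
    rw [pairHeight_comm] at h1
    exact absurd (pairHeight_trans h1 h2) (not_le.2 hvw)

/-- The edges to far vertices are independent of the near edges, so that a union bound over the far
vertices and their possible neighbourhoods applies conditionally. -/
theorem law_isolatedClique_inter_farAttached_le (hc : 1 < c) (α : ℝ) {h t : ℕ} (hH : h + t ≤ H)
    (v : Leaf b H) :
    (law b H c hc).real (isolatedClique v h t ∩ farAttached α v h t) ≤
      (∑ u with u ∉ subtree v (h + t), 2 ^ (b ^ h) * c ^ (-(pairHeight u v * (α * (b : ℝ) ^ h)))) *
        (law b H c hc).real (isolatedClique v h t) := by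
  classical
  have hc0 : 0 < c := by linarith
  have hS : (subtree v h).card = b ^ h := card_subtree v (by omega)
  let U : Finset (Leaf b H) := Finset.univ.filter fun u => u ∉ subtree v (h + t)
  let 𝓣 : Finset (Finset (Leaf b H)) := (subtree v h).powerset.filter fun T =>
    α * (b : ℝ) ^ h < (T.card : ℝ)
  let star : Leaf b H → Finset (Leaf b H) → Finset (Sym2 (Leaf b H)) := fun u T =>
    T.image fun x => s(u, x)
  have hsub : isolatedClique v h t ∩ farAttached α v h t ⊆
      ⋃ u ∈ U, ⋃ T ∈ 𝓣, isolatedClique v h t ∩ {G | ∀ e ∈ star u T, G e = true} := by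
    rintro G ⟨hG, u, hu, hlt⟩
    refine Set.mem_biUnion (Finset.mem_filter.2 ⟨Finset.mem_univ u, hu⟩)
      (Set.mem_biUnion (x := (subtree v h).filter fun x => G s(u, x) = true)
        (Finset.mem_filter.2 ⟨Finset.mem_powerset.2 (Finset.filter_subset _ _), ?_⟩) ⟨hG, ?_⟩)
    · rw [hS, Nat.cast_pow] at hlt
      exact hlt
    · intro e he
      obtain ⟨x, hx, rfl⟩ := Finset.mem_image.1 he
      exact (Finset.mem_filter.1 hx).2
  have hstar : ∀ u ∈ U, ∀ T ∈ 𝓣,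
      (law b H c hc).real (isolatedClique v h t ∩ {G | ∀ e ∈ star u T, G e = true}) ≤
        c ^ (-(pairHeight u v * (α * (b : ℝ) ^ h))) *
          (law b H c hc).real (isolatedClique v h t) := by
    intro u hu T hT
    have huB := (Finset.mem_filter.1 hu).2
    obtain ⟨hTS, hTα⟩ := Finset.mem_filter.1 hT
    rw [Finset.mem_powerset] at hTS
    have hdisj : Disjoint (nearEdges v h t) (star u T) := by
      refine Finset.disjoint_left.2 fun e he he' => huB ?_
      obtain ⟨x, _, rfl⟩ := Finset.mem_image.1 he'
      exact mem_subtree_of_mem_nearEdges he (Sym2.mem_mk_left u x)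
    have hfar : ∀ x ∈ T, pairHeight u v ≤ pairHeight u x := by
      intro x hx
      by_contra! hlt
      have h1 := pairHeight_le_iff.2 (hTS hx)
      have h2 : ¬ pairHeight u v ≤ h + t := fun h3 => huB (pairHeight_le_iff.1 h3)
      have h3 := pairHeight_trans (k := pairHeight u v - 1) (u := u) (v := x) (w := v)
        (by omega) (by omega)
      omega
    have h1 := law_cylinder_inter (hc := hc) hdisj (fun e => decide (edgeHeight e ≤ h))
      fun _ => true
    rw [isolatedClique, h1, law_all_present, mul_comm]
    refine mul_le_mul_of_nonneg_right ?_ measureReal_nonneg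
    rw [Finset.prod_image fun x _ y _ hxy => Sym2.congr_right.1 hxy]
    calc ∏ x ∈ T, (c ^ edgeHeight s(u, x))⁻¹
        ≤ ∏ _x ∈ T, (c ^ pairHeight u v)⁻¹ := by
          refine Finset.prod_le_prod (fun x _ => by positivity) fun x hx => ?_
          exact inv_anti₀ (by positivity) (pow_le_pow_right₀ hc.le (hfar x hx))
      _ = c ^ (-((pairHeight u v : ℝ) * T.card)) := by
          rw [Finset.prod_const, inv_pow, ← pow_mul, Real.rpow_neg hc0.le, ← Nat.cast_mul,
            Real.rpow_natCast]
      _ ≤ c ^ (-(pairHeight u v * (α * (b : ℝ) ^ h))) := by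
          refine Real.rpow_le_rpow_of_exponent_le hc.le (neg_le_neg ?_)
          exact mul_le_mul_of_nonneg_left hTα.le (Nat.cast_nonneg _)
  calc (law b H c hc).real (isolatedClique v h t ∩ farAttached α v h t)
      ≤ (law b H c hc).real
          (⋃ u ∈ U, ⋃ T ∈ 𝓣, isolatedClique v h t ∩ {G | ∀ e ∈ star u T, G e = true}) :=
        measureReal_mono hsub (measure_ne_top _ _)
    _ ≤ ∑ u ∈ U, (law b H c hc).real
          (⋃ T ∈ 𝓣, isolatedClique v h t ∩ {G | ∀ e ∈ star u T, G e = true}) :=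
        measureReal_biUnion_finset_le _ _
    _ ≤ ∑ u ∈ U, 2 ^ (b ^ h) * c ^ (-(pairHeight u v * (α * (b : ℝ) ^ h))) *
          (law b H c hc).real (isolatedClique v h t) := by
        refine Finset.sum_le_sum fun u hu => (measureReal_biUnion_finset_le _ _).trans ?_
        refine (Finset.sum_le_sum (hstar u hu)).trans ?_
        rw [Finset.sum_const, nsmul_eq_mul, mul_assoc]
        refine mul_le_mul_of_nonneg_right ?_
          (mul_nonneg (Real.rpow_nonneg hc0.le _) measureReal_nonneg)
        have h1 : 𝓣.card ≤ 2 ^ (b ^ h) := by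
          rw [← hS, ← Finset.card_powerset]
          exact Finset.card_filter_le _ _
        exact_mod_cast h1
    _ = _ := by rw [Finset.sum_mul]

/-- The union bound over the far vertices is small: by `hgap` the number `b ^ k` of vertices at
distance `k` is beaten by the probability `c ^ (-k α m)`, with `m = b ^ h`, that one of them has
`α m` given neighbours. -/
theorem sum_far_le (hb : 1 ≤ b) (hc : 1 < c) {α μ : ℝ} (hα : 0 < α) (hμ : 0 < μ) {h t : ℕ}
    (hgap : Real.log b ≤ α * (1 - μ) * (b : ℝ) ^ h * Real.log c)
    (ht : 2 ≤ c ^ (α * μ / 2 * t)) (v : Leaf b H) :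
    ∑ u with u ∉ subtree v (h + t), 2 ^ (b ^ h) * c ^ (-(pairHeight u v * (α * (b : ℝ) ^ h))) ≤
      (c ^ (-(α * μ / 2))) ^ t / (1 - c ^ (-(α * μ / 2))) := by
  classical
  have hc0 : 0 < c := by linarith
  have hb0 : (0 : ℝ) < b := by exact_mod_cast hb
  set ρ : ℝ := c ^ (-(α * μ / 2)) with hρ
  have hρ1 : ρ < 1 := Real.rpow_lt_one_of_one_lt_of_neg hc (by simp; positivity)
  have hρ0 : 0 ≤ ρ := Real.rpow_nonneg hc0.le _
  set m : ℝ := (b : ℝ) ^ h with hm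
  have hm1 : 1 ≤ m := one_le_pow₀ (by exact_mod_cast hb)
  let f : ℕ → ℝ := fun k => if t ≤ k then 2 ^ (b ^ h) * c ^ (-(k * (α * m))) else 0
  have hf : ∀ k, 0 ≤ f k := by
    intro k
    simp only [f]
    split_ifs
    · have := Real.rpow_nonneg hc0.le (-(k * (α * m)))
      positivity
    · exact le_rfl
  have hterm : ∀ k : ℕ, t ≤ k → (b : ℝ) ^ k * (2 ^ (b ^ h) * c ^ (-(k * (α * m)))) ≤ ρ ^ k := by
    intro k hk
    have hk' : (t : ℝ) ≤ k := Nat.cast_le.2 hk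
    have h1 : (b : ℝ) ^ k ≤ c ^ (α * (1 - μ) * m * k) := by
      rw [Real.rpow_mul hc0.le, Real.rpow_natCast]
      refine pow_le_pow_left₀ hb0.le ?_ _
      rwa [Real.le_rpow_iff_log_le hb0 hc0]
    have h2 : (2 : ℝ) ^ (b ^ h) ≤ c ^ (α * μ / 2 * k * m) := by
      rw [Real.rpow_mul hc0.le, hm, ← Nat.cast_pow, Real.rpow_natCast]
      refine pow_le_pow_left₀ (by norm_num) (ht.trans ?_) _
      exact Real.rpow_le_rpow_of_exponent_le hc.le (by gcongr)
    calc (b : ℝ) ^ k * (2 ^ (b ^ h) * c ^ (-(k * (α * m))))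
        ≤ c ^ (α * (1 - μ) * m * k) * (c ^ (α * μ / 2 * k * m) * c ^ (-(k * (α * m)))) := by
          gcongr
      _ = c ^ (-(α * μ / 2) * k * m) := by
          rw [← Real.rpow_add hc0, ← Real.rpow_add hc0]
          congr 1
          ring
      _ ≤ c ^ (-(α * μ / 2) * k) := by
          refine Real.rpow_le_rpow_of_exponent_le hc.le ?_
          have : 0 ≤ α * μ / 2 * k := by positivity
          nlinarith
      _ = ρ ^ k := by rw [Real.rpow_mul hc0.le, Real.rpow_natCast]
  calc ∑ u with u ∉ subtree v (h + t), 2 ^ (b ^ h) * c ^ (-(pairHeight u v * (α * m)))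
      = ∑ u with u ∉ subtree v (h + t), f (pairHeight u v) := by
        refine Finset.sum_congr rfl fun u hu => ?_
        have h1 : ¬ pairHeight u v ≤ h + t := fun h1 =>
          (Finset.mem_filter.1 hu).2 (pairHeight_le_iff.1 h1)
        simp only [f]
        rw [if_pos (by omega)]
    _ ≤ ∑ u : Leaf b H, f (pairHeight u v) :=
        Finset.sum_le_sum_of_subset_of_nonneg (Finset.filter_subset _ _) fun u _ _ => hf _
    _ ≤ ∑ k ∈ Finset.range (H + 1), (b : ℝ) ^ k * f k := sum_pairHeight_le hb v hf
    _ ≤ ∑ k ∈ Finset.range (H + 1), if t ≤ k then ρ ^ k else 0 := by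
        refine Finset.sum_le_sum fun k _ => ?_
        simp only [f]
        split_ifs with hk
        · exact hterm k hk
        · rw [mul_zero]
    _ = ∑ k ∈ Finset.Ico t (H + 1), ρ ^ k := by
        rw [← Finset.sum_filter]
        congr 1
        ext k
        simp [and_comm]
    _ ≤ ρ ^ t / (1 - ρ) := geom_sum_Ico_le_of_lt_one hρ0 hρ1

/-- A lower bound for the number of complete clusters, with the probability of its failure. -/
theorem law_few_clusters_le (hb : 2 ≤ b) (hc : 1 < c) {α β : ℝ} (hα : 0 ≤ α) (hβ : β ≤ 1)
    {h t : ℕ} (hH : h + t ≤ H) {η A Q : ℝ} (hA : 0 < A)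
    (hη : ∀ v : Leaf b H, ∑ u with u ∉ subtree v (h + t),
      2 ^ (b ^ h) * c ^ (-(pairHeight u v * (α * (b : ℝ) ^ h))) ≤ η)
    (hAle : A * (b : ℝ) ^ (h + t) ≤
      (b : ℝ) ^ H * ((1 - c⁻¹) * (c ^ h)⁻¹) ^ (b ^ h * b ^ (h + t)))
    (hQ : Q ≤ A / 4) :
    (law b H c hc).real {G | ¬ Q ≤ (({M : Finset (Leaf b H) | IsComplete M ∧ M.card = b ^ h ∧
      IsCluster α β G M}.ncard : ℕ) : ℝ)} ≤ 4 / A + 4 * η := by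
  classical
  have hb0 : (0 : ℝ) < b := by exact_mod_cast (by omega : 0 < b)
  obtain ⟨R, hR, hRcard⟩ := exists_separated (b := b) (H := H) (by omega) hH
  set κ : ℝ := ((1 - c⁻¹) * (c ^ h)⁻¹) ^ (b ^ h * b ^ (h + t)) with hκ
  have hκ0 : 0 ≤ κ := by
    have h1 : c⁻¹ ≤ 1 := inv_le_one_of_one_le₀ hc.le
    have h2 : 0 ≤ (c ^ h)⁻¹ := inv_nonneg.2 (pow_nonneg (by linarith) _)
    exact pow_nonneg (mul_nonneg (by linarith) h2) _
  set S : ℝ := ∑ v ∈ R, (law b H c hc).real (isolatedClique v h t) with hS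
  have hAS : A ≤ S := by
    have h1 : R.card * κ ≤ S := by
      rw [← nsmul_eq_mul, ← Finset.sum_const]
      exact Finset.sum_le_sum fun v _ => le_law_isolatedClique hc hH v
    have h2 : (b : ℝ) ^ H ≤ R.card * (b : ℝ) ^ (h + t) := by exact_mod_cast hRcard
    have h3 : A * (b : ℝ) ^ (h + t) ≤ R.card * κ * (b : ℝ) ^ (h + t) := by
      calc _ ≤ (b : ℝ) ^ H * κ := hAle
        _ ≤ R.card * (b : ℝ) ^ (h + t) * κ := mul_le_mul_of_nonneg_right h2 hκ0
        _ = _ := by ring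
    exact (le_of_mul_le_mul_right h3 (by positivity)).trans h1
  let good : Graph b H → Finset (Leaf b H) := fun G =>
    R.filter fun v => IsCluster α β G (subtree v h)
  have hcount := measureReal_count_lt_le (law b H c hc) R (fun v => isolatedClique v h t)
    (fun v => farAttached α v h t) (η := η) hS (hA.trans_le hAS)
    (fun v hv w hw hne => law_isolatedClique_inter (hR v hv w hw hne))
    (fun v _ => (law_isolatedClique_inter_farAttached_le hc α hH v).trans
      (mul_le_mul_of_nonneg_right (hη v) measureReal_nonneg)) good
    fun G v hv h1 h2 => Finset.mem_filter.2 ⟨hv, isCluster_of_isolatedClique hα hβ h1 h2⟩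
  refine (measureReal_mono (fun G hG => ?_) (measure_ne_top _ _)).trans (hcount.trans ?_)
  · refine lt_of_le_of_lt ?_ ((not_le.1 hG).trans_le (hQ.trans (by linarith)))
    rw [Nat.cast_le, ← Finset.card_image_of_injOn (s := good G) (f := fun v => subtree v h),
      ← Set.ncard_coe_finset]
    · refine Set.ncard_le_ncard (fun M hM => ?_) (Set.toFinite _)
      obtain ⟨v, hv, rfl⟩ := Finset.mem_image.1 (Finset.mem_coe.1 hM)
      exact ⟨isComplete_subtree hb v (by omega), card_subtree v (by omega),
        (Finset.mem_filter.1 hv).2⟩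
    · intro v hv w hw hvw
      by_contra hne
      have h1 := hR v (Finset.mem_filter.1 hv).1 w (Finset.mem_filter.1 hw).1 hne
      have hvw : subtree v h = subtree w h := hvw
      have h2 := pairHeight_le_iff.2 (hvw ▸ mem_subtree_self v h)
      omega
  · have h1 : 4 / S ≤ 4 / A := div_le_div_of_nonneg_left (by norm_num) hA hAS
    linarith

end Isolated

/-! ### Asymptotics -/

theorem eventually_rpow_mul_log_le {s : ℝ} (hs : s < 1) (C D : ℝ) {δ : ℝ} (hδ : 0 < δ) :
    ∀ᶠ x : ℝ in atTop, x ^ s * (C * Real.log x + D) ≤ δ * x := by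
  have hs' : 0 < 1 - s := by linarith
  have h1 : (fun x : ℝ => C * Real.log x + D) =o[atTop] fun x : ℝ => x ^ (1 - s) :=
    ((isLittleO_log_rpow_atTop hs').const_mul_left C).add
      (Asymptotics.isLittleO_const_left.2
        (Or.inr (tendsto_norm_atTop_atTop.comp (tendsto_rpow_atTop hs'))))
  filter_upwards [h1.bound hδ, eventually_gt_atTop 0] with x hx hx0
  rw [Real.norm_of_nonneg (Real.rpow_nonneg hx0.le _)] at hx
  calc x ^ s * (C * Real.log x + D) ≤ x ^ s * (δ * x ^ (1 - s)) :=
        mul_le_mul_of_nonneg_left ((le_abs_self _).trans hx) (Real.rpow_nonneg hx0.le _)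
    _ = δ * (x ^ s * x ^ (1 - s)) := by ring
    _ = δ * x := by rw [← Real.rpow_add hx0, add_sub_cancel, Real.rpow_one]

/-- As `h` is an integer, `b ^ h` exceeds `m⋆ = ln b / (α ln c)` by a constant factor as soon as it
exceeds it at all. -/
theorem exists_gap {b : ℕ} (hb : 2 ≤ b) {c : ℝ} (hc : 1 < c) {α : ℝ} (hα : 0 < α) :
    ∃ μ : ℝ, 0 < μ ∧ ∀ h : ℕ, Real.logb (b : ℝ) (Real.log b / (α * Real.log c)) < (h : ℝ) →
      Real.log b ≤ α * (1 - μ) * (b : ℝ) ^ h * Real.log c := by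
  classical
  have hlogc : 0 < Real.log c := Real.log_pos hc
  have hlogb : 0 < Real.log b := log_pos_of_two_le hb
  have hb1 : (1 : ℝ) < b := by exact_mod_cast (by omega : 1 < b)
  set m : ℝ := Real.log b / (α * Real.log c) with hm
  have hm0 : 0 < m := by positivity
  have hex : ∃ h : ℕ, Real.logb (b : ℝ) m < h := exists_nat_gt _
  have hspec : m < (b : ℝ) ^ Nat.find hex := by
    have h1 := Nat.find_spec hex
    rwa [Real.logb_lt_iff_lt_rpow hb1 hm0, Real.rpow_natCast] at h1
  set m₀ : ℝ := (b : ℝ) ^ Nat.find hex with hm₀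
  have hm₀0 : 0 < m₀ := hm0.trans hspec
  refine ⟨1 - m / m₀, by rw [sub_pos, div_lt_one hm₀0]; exact hspec, fun h hh => ?_⟩
  have h1 : m₀ ≤ (b : ℝ) ^ h := pow_le_pow_right₀ hb1.le (Nat.find_min' hex hh)
  have h2 : m ≤ m / m₀ * (b : ℝ) ^ h := by
    rw [div_mul_eq_mul_div, le_div_iff₀ hm₀0]
    exact mul_le_mul_of_nonneg_left h1 hm0.le
  calc Real.log b = α * Real.log c * m := by
        rw [hm]
        field_simp
    _ ≤ α * Real.log c * (m / m₀ * (b : ℝ) ^ h) :=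
        mul_le_mul_of_nonneg_left h2 (by positivity)
    _ = α * (1 - (1 - m / m₀)) * (b : ℝ) ^ h * Real.log c := by ring

theorem AAS_many_complete_clusters {b : ℕ} (hb : 2 ≤ b) {c : ℝ} (hc : 1 < c) {α β ε : ℝ}
    (hα : 0 < α) (hβ : β ≤ 1) (hε : 0 < ε) {h : ℕ → ℕ}
    (hh : ∀ᶠ H in atTop,
      Real.logb (b : ℝ) (Real.log b / (α * Real.log c)) < (h H : ℝ) ∧
      (h H : ℝ) ≤ (1 / 2 - ε) * (Real.log (logSize b H) / Real.log b)) :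
    AAS b c hc fun H G => logSize b H ^ ((b : ℝ) ^ h H) ≤
      (({M : Finset (Leaf b H) | IsComplete M ∧ M.card = b ^ h H ∧
        IsCluster α β G M}.ncard : ℕ) : ℝ) := by
  have hc0 : 0 < c := by linarith
  have hlogc : 0 < Real.log c := Real.log_pos hc
  have hlogb : 0 < Real.log b := log_pos_of_two_le hb
  have hb0 : (0 : ℝ) < b := by exact_mod_cast (by omega : 0 < b)
  have hκ : 0 < 1 - c⁻¹ := sub_pos.2 (inv_lt_one_of_one_lt₀ hc)
  obtain ⟨μ, hμ, hgap⟩ := exists_gap hb hc hα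
  have hLtop := tendsto_logSize hb
  have hlogtop : Tendsto (fun H => Real.log (logSize b H)) atTop atTop :=
    Real.tendsto_log_atTop.comp hLtop
  -- The width of the isolating layer: it grows, but costs only a factor `L ^ ε`, `L = ln n`.
  let t : ℕ → ℕ := fun H => ⌊ε * Real.log (logSize b H) / Real.log b⌋₊
  have httop : Tendsto t atTop atTop :=
    tendsto_nat_floor_atTop.comp ((hlogtop.const_mul_atTop hε).atTop_div_const hlogb)
  set ρ : ℝ := c ^ (-(α * μ / 2)) with hρ
  have hρ0 : 0 ≤ ρ := Real.rpow_nonneg hc0.le _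
  have hρ1 : ρ < 1 := Real.rpow_lt_one_of_one_lt_of_neg hc (by simp; positivity)
  refine AAS_of_tendsto (δ := fun H => 4 / Real.exp (logSize b H / 2) +
    4 * (ρ ^ t H / (1 - ρ))) ?_ ?_
  · have h1 : Tendsto (fun H => 4 / Real.exp (logSize b H / 2)) atTop (𝓝 0) :=
      (Real.tendsto_exp_atTop.comp (hLtop.atTop_div_const two_pos)).const_div_atTop 4
    have h2 : Tendsto (fun H => ρ ^ t H) atTop (𝓝 0) :=
      (tendsto_pow_atTop_nhds_zero_of_lt_one hρ0 hρ1).comp httop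
    simpa using h1.add ((h2.div_const (1 - ρ)).const_mul 4)
  · filter_upwards [hh, hlogtop.eventually_ge_atTop 0, hLtop.eventually_gt_atTop 0,
      httop.eventually_ge_atTop ⌈2 * Real.log 2 / (α * μ * Real.log c)⌉₊,
      hLtop.eventually (eventually_rpow_mul_log_le (s := 1 - ε) (by linarith)
        (Real.log c / (2 * Real.log b)) (-Real.log (1 - c⁻¹)) (δ := 1 / 4) (by norm_num)),
      hLtop.eventually (eventually_rpow_mul_log_le (s := 1 / 2) (by norm_num)
        1 (Real.log 4) (δ := 1 / 2) (by norm_num))]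
      with H hhH hl0 hL0 htge hE1 hE2
    obtain ⟨hh1, hh2⟩ := hhH
    set L := logSize b H with hL
    set l := Real.log L with hl
    have hexpL : ∀ s : ℝ, L ^ s = Real.exp (s * l) := fun s => by
      rw [Real.rpow_def_of_pos hL0, mul_comm]
    have hhl : h H * Real.log b ≤ (1 / 2 - ε) * l := by
      rw [mul_div_assoc', le_div_iff₀ hlogb] at hh2
      exact hh2
    have htl : t H * Real.log b ≤ ε * l := by
      rw [← le_div_iff₀ hlogb]
      exact Nat.floor_le (by positivity)
    have hlL : l ≤ L := Real.log_le_self hL0.le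
    have hLH : L = H * Real.log b := logSize_eq b H
    have hht : ((h H + t H : ℕ) : ℝ) * Real.log b ≤ l / 2 := by
      push_cast
      linarith
    have hH : h H + t H ≤ H := by
      have h1 : ((h H + t H : ℕ) : ℝ) * Real.log b ≤ H * Real.log b := by linarith
      exact_mod_cast le_of_mul_le_mul_right h1 hlogb
    have hpow : ∀ k : ℕ, (b : ℝ) ^ k = Real.exp (k * Real.log b) := fun k => by
      rw [Real.exp_nat_mul, Real.exp_log hb0]
    refine law_few_clusters_le hb hc hα.le hβ hH (Real.exp_pos _)
      (fun v => sum_far_le (by omega) hc hα hμ (hgap _ hh1) ?_ v) ?_ ?_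
    · have h1 := Nat.ceil_le.1 htge
      rw [div_le_iff₀ (by positivity)] at h1
      rw [Real.le_rpow_iff_log_le two_pos hc0]
      linarith
    · -- The probability of an isolated clique is `n ^ (-o(1))`, its logarithm being bounded by the
      -- number of near edges, at most `L ^ (1 - ε)`, times `O(h + 1)`.
      have hbase : (1 - c⁻¹) * (c ^ h H)⁻¹ =
          Real.exp (-(h H * Real.log c - Real.log (1 - c⁻¹))) := by
        rw [neg_sub, Real.exp_sub, Real.exp_log hκ, Real.exp_nat_mul, Real.exp_log hc0,
          div_eq_mul_inv]
      have hlogκ : Real.log (1 - c⁻¹) ≤ 0 := by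
        refine Real.log_nonpos hκ.le ?_
        have : 0 < c⁻¹ := inv_pos.2 hc0
        linarith
      have hhc : h H * Real.log c ≤ Real.log c / (2 * Real.log b) * l := by
        have h1 : (h H : ℝ) ≤ l / (2 * Real.log b) := by
          rw [le_div_iff₀ (by positivity)]
          nlinarith
        calc h H * Real.log c ≤ l / (2 * Real.log b) * Real.log c :=
              mul_le_mul_of_nonneg_right h1 hlogc.le
          _ = _ := by ring
      have hnum : ((b ^ h H * b ^ (h H + t H) : ℕ) : ℝ) ≤ L ^ (1 - ε) := by
        push_cast
        rw [hpow, hpow, ← Real.exp_add, hexpL, Real.exp_le_exp]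
        push_cast
        linarith
      have hcost : ((b ^ h H * b ^ (h H + t H) : ℕ) : ℝ) *
          (h H * Real.log c - Real.log (1 - c⁻¹)) ≤ 1 / 4 * L := by
        refine le_trans (mul_le_mul hnum (by linarith) ?_ (Real.rpow_nonneg hL0.le _)) hE1
        have : 0 ≤ h H * Real.log c := by positivity
        linarith
      have hl4 : l / 2 ≤ 1 / 4 * L := by
        have h1 := Real.log_le_sub_one_of_pos (x := L / 2) (by positivity)
        rw [Real.log_div hL0.ne' two_ne_zero] at h1
        linarith [Real.log_two_lt_d9]
      rw [hbase, ← Real.exp_nat_mul, hpow (h H + t H), hpow H, ← hLH, ← Real.exp_add,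
        ← Real.exp_add, Real.exp_le_exp]
      linarith
    · have hm : (b : ℝ) ^ h H ≤ L ^ (1 / 2 : ℝ) := by
        rw [hpow, hexpL, Real.exp_le_exp]
        nlinarith
      have hm1 : 1 ≤ (b : ℝ) ^ h H := one_le_pow₀ (by exact_mod_cast (by omega : 1 ≤ b))
      have h4 : 0 ≤ Real.log 4 := Real.log_nonneg (by norm_num)
      rw [le_div_iff₀ (by norm_num), hexpL]
      calc Real.exp ((b : ℝ) ^ h H * l) * 4
          = Real.exp ((b : ℝ) ^ h H * l + Real.log 4) := by
            rw [Real.exp_add, Real.exp_log (by norm_num)]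
        _ ≤ Real.exp (L / 2) := by
            rw [Real.exp_le_exp]
            have h5 : (b : ℝ) ^ h H * (l + Real.log 4) ≤ L ^ (1 / 2 : ℝ) * (l + Real.log 4) :=
              mul_le_mul_of_nonneg_right hm (by linarith)
            nlinarith

theorem AAS_exists_cluster {b : ℕ} (hb : 2 ≤ b) {c : ℝ} (hc : 1 < c) {α β ε : ℝ}
    (hα : 0 < α) (hβ : β ≤ 1) (hε : 0 < ε) :
    AAS b c hc fun H G => ∃ M : Finset (Leaf b H),
      IsCluster α β G M ∧ logSize b H ^ (1 / 2 - ε : ℝ) < (M.card : ℝ) := by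
  have hlogb : 0 < Real.log b := log_pos_of_two_le hb
  have hb0 : (0 : ℝ) < b := by exact_mod_cast (by omega : 0 < b)
  have hLtop := tendsto_logSize hb
  have hlogtop : Tendsto (fun H => Real.log (logSize b H)) atTop atTop :=
    Real.tendsto_log_atTop.comp hLtop
  -- A smaller `ε'` leaves room for rounding, and `ε' < 1 / 2` makes the size grow.
  set ε' := min (ε / 2) (1 / 4) with hε'
  have hε'0 : 0 < ε' := lt_min (by positivity) (by norm_num)
  have hε'1 : ε' ≤ ε / 2 := min_le_left _ _
  have hε'2 : ε' ≤ 1 / 4 := min_le_right _ _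
  let x : ℕ → ℝ := fun H => (1 / 2 - ε') * (Real.log (logSize b H) / Real.log b)
  have hxtop : Tendsto x atTop atTop :=
    (hlogtop.atTop_div_const hlogb).const_mul_atTop (by linarith)
  have hmany := AAS_many_complete_clusters hb hc (β := β) hα hβ hε'0 (h := fun H => ⌊x H⌋₊) (by
    filter_upwards [((tendsto_natCast_atTop_atTop (R := ℝ)).comp
      (tendsto_nat_floor_atTop.comp hxtop)).eventually_gt_atTop
        (Real.logb (b : ℝ) (Real.log b / (α * Real.log c))), hxtop.eventually_ge_atTop 0]
      with H h1 h2
    exact ⟨h1, Nat.floor_le h2⟩)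
  refine hmany.mono ?_
  filter_upwards [hLtop.eventually_gt_atTop 0,
    hlogtop.eventually_gt_atTop (2 * Real.log b / ε)] with H hL0 hl G hG
  have hpos : 0 < {M : Finset (Leaf b H) | IsComplete M ∧ M.card = b ^ ⌊x H⌋₊ ∧
      IsCluster α β G M}.ncard := by
    exact_mod_cast (Real.rpow_pos_of_pos hL0 _).trans_le hG
  obtain ⟨M, _, hcard, hM⟩ := Set.nonempty_of_ncard_ne_zero hpos.ne'
  refine ⟨M, hM, ?_⟩
  rw [hcard, Nat.cast_pow, Real.rpow_def_of_pos hL0, ← Real.exp_log hb0, ← Real.exp_nat_mul,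
    Real.exp_lt_exp]
  rw [div_lt_iff₀ hε] at hl
  have h1 : x H - 1 < ⌊x H⌋₊ := by linarith [Nat.lt_floor_add_one (x H)]
  have h2 : x H * Real.log b = (1 / 2 - ε') * Real.log (logSize b H) := by
    simp only [x]
    field_simp
  have h3 : (x H - 1) * Real.log b < ⌊x H⌋₊ * Real.log b := mul_lt_mul_of_pos_right h1 hlogb
  have h4 : 0 ≤ (ε / 2 - ε') * Real.log (logSize b H) := by
    refine mul_nonneg (by linarith) ?_
    by_contra! hneg
    nlinarith
  nlinarith

end CGA

theorem theorem1 (b : ℕ) (hb : 2 ≤ b) (c : ℝ) (hc : 1 < c)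
    (α : ℝ) (hα₀ : 0 < α) (hα₁ : α ≤ 1) :
    ∃ γ : ℝ, 0 < γ ∧ ∀ β : ℝ, 0 < β → β ≤ 1 → ∀ ε : ℝ, 0 < ε →
      -- existence of clusters below the threshold
      CGA.AAS b c hc (fun H G => ∃ M : Finset (CGA.Leaf b H),
        CGA.IsCluster α β G M ∧ CGA.logSize b H ^ (1 / 2 - ε : ℝ) < (M.card : ℝ)) ∧
      -- many complete clusters, for heights that may vary with the size of the tree
      (∀ h : ℕ → ℕ,
        (∀ᶠ H in atTop,
          Real.logb (b : ℝ) (Real.log b / (α * Real.log c)) < (h H : ℝ) ∧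
          (h H : ℝ) ≤ (1 / 2 - ε) * (Real.log (CGA.logSize b H) / Real.log b)) →
        CGA.AAS b c hc (fun H G =>
          CGA.logSize b H ^ (γ * (b : ℝ) ^ h H) ≤
            (({M : Finset (CGA.Leaf b H) | CGA.IsComplete M ∧ M.card = b ^ h H ∧
              CGA.IsCluster α β G M}.ncard : ℕ) : ℝ))) ∧
      -- no clusters above the threshold
      CGA.AAS b c hc (fun H G => ¬ ∃ M : Finset (CGA.Leaf b H),
        CGA.IsCluster α β G M ∧ CGA.logSize b H ^ (1 / 2 + ε : ℝ) < (M.card : ℝ)) := by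
  refine ⟨1, one_pos, fun β hβ₀ hβ₁ ε hε => ⟨CGA.AAS_exists_cluster hb hc hα₀ hβ₁ hε,
    fun h hh => ?_, CGA.AAS_no_large_cluster hb hc α hβ₀ hε⟩⟩
  simp_rw [one_mul]
  exact CGA.AAS_many_complete_clusters hb hc hα₀ hβ₁ hε hh
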